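/- Let $\sigma:\mathbb R\to\mathbb R$ be a $C^2$ function of one of the following two types. Type I (quadratic-like): $\sigma$ is strictly convex and attains its minimum at some point $\alpha$, and $\sigma''(u)>0$ for all $u\le\alpha$. Type II (cubic-like): there are real numbers $\alpha<\beta$ such that $\sigma'(u)<0$ for $u<\alpha$ and for $u>\beta$, $\sigma'(u)>0$ for $u\in(\alpha,\beta)$, $\sigma''(u)>0$ for $u\le\alpha$, and $\sigma''(u)<0$ for $u\ge\beta$. Then every $C^2$ solution $(u(t,x),v(t,x))$ of the system $$u_t=-v_x,\qquad v_t=(\sigma(u))_x$$ defined on the whole cylinder $\mathbb R\times S^1$, that is, for all $(t,x)\in\mathbb R^2$ and with $$u(t,x+1)=u(t,x),\qquad v(t,x+1)=v(t,x),$$ is constant: there are $a,b\in\mathbb R$ with $u(t,x)=a$ and $v(t,x)=b$ for all $t,x$. -/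

import Mathlib

/-- Quadratic-like stress functions: `σ` is of class `C²`, strictly convex and attains a minimum,
at the point `α`.  The system is hyperbolic where `u < α`; as for cubic-like functions, the
convexity is nondegenerate (`σ'' > 0`) for `u ≤ α`. -/
structure IsTypeI (σ : ℝ → ℝ) : Prop where
  contDiff : ContDiff ℝ 2 σ
  strictConvex : StrictConvexOn ℝ Set.univ σ
  exists_min : ∃ α : ℝ, IsMinOn σ Set.univ α ∧ ∀ u, u ≤ α → 0 < deriv (deriv σ) u

/-- Cubic-like stress functions: `σ` is of class `C²`, with `σ' < 0` outside `[α, β]`, `σ' > 0` on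
`(α, β)`, `σ'' > 0` for `u ≤ α` and `σ'' < 0` for `u ≥ β`. -/
structure IsTypeII (σ : ℝ → ℝ) : Prop where
  contDiff : ContDiff ℝ 2 σ
  exists_signs : ∃ α β : ℝ, α < β ∧
    (∀ u, u < α → deriv σ u < 0) ∧
    (∀ u, β < u → deriv σ u < 0) ∧
    (∀ u, α < u → u < β → 0 < deriv σ u) ∧
    (∀ u, u ≤ α → 0 < deriv (deriv σ) u) ∧
    (∀ u, β ≤ u → deriv (deriv σ) u < 0)

/-- `(u, v)`, functions of `(t, x) ∈ ℝ × ℝ`, is a `C²` solution on the whole plane of the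
`p`-system `u_t = -v_x`, `v_t = (σ(u))_x`. -/
structure IsPSystemSolution (σ : ℝ → ℝ) (u v : ℝ → ℝ → ℝ) : Prop where
  contDiff_u : ContDiff ℝ 2 (fun p : ℝ × ℝ => u p.1 p.2)
  contDiff_v : ContDiff ℝ 2 (fun p : ℝ × ℝ => v p.1 p.2)
  eq_u : ∀ t x : ℝ, deriv (fun s => u s x) t = -deriv (fun y => v t y) x
  eq_v : ∀ t x : ℝ, deriv (fun s => v s x) t = deriv (fun y => σ (u t y)) x

open Set Filter Topology MeasureTheory

/-! The system is hyperbolic with speeds `±λ`, `λ = √(-σ')`, where `σ'(u) < 0`, and elliptic where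
`σ'(u) > 0`. The aim is to show that `u` does not cross the sonic values, after which each regime is
rigid by itself.

In `u < α`, Lax's Riccati equation (`riccati`) makes the weighted derivative `wave` grow along
right-moving characteristics. A positive `wave` keeps the characteristic away from the sonic line,
where `λ = 0`, so it exists for all later times (`exists_isCharacteristic`). It also winds around
the circle (`exists_winding_time`): where `λ` is small, `gain` is bounded below, and the total gain
is limited by `1 / w₀`. If both families carried a positive wave, their characteristics would cut
the cylinder into cells with boundary in `u < α`. The maximum principle for the elliptic equation
then gives `u ≤ α` at all large times (`Cell.le`). But there the Riemann invariants are bounded, so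
`u` is bounded below and the Riccati equation blows up in finite time. This is `not_both_pos`.

At a point with `u = α` and `u_t < 0`, both families would have positive waves nearby. Hence `u_t ≥
0` at sonic points, and `u_t = 0` after time reversal. With no motion through the sonic values, the
integral of `exp (-u)` over a period, with `u` clamped to the elliptic band, is convex and bounded
on the whole time line. It is therefore constant, and `u` is stationary in the band
(`Band.stationary`). By connectedness, `u` is either constant or confined to one hyperbolic
half-line, where blow-up for all mirror images forces constancy (`const_of_le`). -/

/-! ### Partial derivatives in the plane -/

/-- The derivative in the first (time) variable. -/
noncomputable def dt (F : ℝ × ℝ → ℝ) (p : ℝ × ℝ) : ℝ := deriv (fun s => F (s, p.2)) p.1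

/-- The derivative in the second (space) variable. -/
noncomputable def dx (F : ℝ × ℝ → ℝ) (p : ℝ × ℝ) : ℝ := deriv (fun y => F (p.1, y)) p.2

section Partial

variable {F : ℝ × ℝ → ℝ}

theorem hasDerivAt_time (hF : ContDiff ℝ 1 F) (p : ℝ × ℝ) :
    HasDerivAt (fun s => F (s, p.2)) (fderiv ℝ F p (1, 0)) p.1 := by
  have h1 : HasFDerivAt F (fderiv ℝ F p) (p.1, p.2) :=
    (hF.differentiable one_ne_zero p).hasFDerivAt
  have h2 : HasDerivAt (fun s : ℝ => (s, p.2)) ((1 : ℝ), (0 : ℝ)) p.1 :=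
    (hasDerivAt_id p.1).prodMk (hasDerivAt_const p.1 p.2)
  exact h1.comp_hasDerivAt p.1 h2

theorem hasDerivAt_space (hF : ContDiff ℝ 1 F) (p : ℝ × ℝ) :
    HasDerivAt (fun y => F (p.1, y)) (fderiv ℝ F p (0, 1)) p.2 := by
  have h1 : HasFDerivAt F (fderiv ℝ F p) (p.1, p.2) :=
    (hF.differentiable one_ne_zero p).hasFDerivAt
  have h2 : HasDerivAt (fun y : ℝ => (p.1, y)) ((0 : ℝ), (1 : ℝ)) p.2 :=
    (hasDerivAt_const p.2 p.1).prodMk (hasDerivAt_id p.2)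
  exact h1.comp_hasDerivAt p.2 h2

theorem dt_eq_fderiv (hF : ContDiff ℝ 1 F) (p : ℝ × ℝ) : dt F p = fderiv ℝ F p (1, 0) :=
  (hasDerivAt_time hF p).deriv

theorem dx_eq_fderiv (hF : ContDiff ℝ 1 F) (p : ℝ × ℝ) : dx F p = fderiv ℝ F p (0, 1) :=
  (hasDerivAt_space hF p).deriv

theorem hasDerivAt_dt (hF : ContDiff ℝ 1 F) (t x : ℝ) :
    HasDerivAt (fun s => F (s, x)) (dt F (t, x)) t := by
  rw [dt_eq_fderiv hF]; exact hasDerivAt_time hF (t, x)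

theorem hasDerivAt_dx (hF : ContDiff ℝ 1 F) (t x : ℝ) :
    HasDerivAt (fun y => F (t, y)) (dx F (t, x)) x := by
  rw [dx_eq_fderiv hF]; exact hasDerivAt_space hF (t, x)

theorem contDiff_dt (hF : ContDiff ℝ 2 F) : ContDiff ℝ 1 (dt F) := by
  have : dt F = fun p => fderiv ℝ F p (1, 0) :=
    funext (dt_eq_fderiv (hF.of_le (by norm_num)))
  rw [this]
  exact (hF.fderiv_right (m := 1) (by norm_num)).clm_apply contDiff_const

theorem contDiff_dx (hF : ContDiff ℝ 2 F) : ContDiff ℝ 1 (dx F) := by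
  have : dx F = fun p => fderiv ℝ F p (0, 1) :=
    funext (dx_eq_fderiv (hF.of_le (by norm_num)))
  rw [this]
  exact (hF.fderiv_right (m := 1) (by norm_num)).clm_apply contDiff_const

theorem continuous_dt (hF : ContDiff ℝ 1 F) : Continuous (dt F) := by
  have : dt F = fun p => fderiv ℝ F p (1, 0) := funext (dt_eq_fderiv hF)
  rw [this]
  exact (hF.continuous_fderiv one_ne_zero).clm_apply continuous_const

theorem continuous_dx (hF : ContDiff ℝ 1 F) : Continuous (dx F) := by
  have : dx F = fun p => fderiv ℝ F p (0, 1) := funext (dx_eq_fderiv hF)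
  rw [this]
  exact (hF.continuous_fderiv one_ne_zero).clm_apply continuous_const

theorem dt_dx_comm (hF : ContDiff ℝ 2 F) (p : ℝ × ℝ) : dt (dx F) p = dx (dt F) p := by
  have hF1 : ContDiff ℝ 1 F := hF.of_le (by norm_num)
  have hd : Differentiable ℝ (fderiv ℝ F) :=
    (hF.fderiv_right (m := 1) (by norm_num)).differentiable one_ne_zero
  have hs : IsSymmSndFDerivAt ℝ F p := hF.contDiffAt.isSymmSndFDerivAt (by simp)
  have key : ∀ e : ℝ × ℝ, ∀ e' : ℝ × ℝ,
      fderiv ℝ (fun q => fderiv ℝ F q e) p e' = fderiv ℝ (fderiv ℝ F) p e' e := by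
    intro e e'
    rw [fderiv_clm_apply (hd p) (differentiableAt_const e)]
    simp
  rw [dt_eq_fderiv (contDiff_dx hF), dx_eq_fderiv (contDiff_dt hF),
    funext (dx_eq_fderiv hF1), funext (dt_eq_fderiv hF1), key, key]
  exact hs _ _

/-- The chain rule along the graph of a function of time. -/
theorem hasDerivWithinAt_along (hF : ContDiff ℝ 1 F) {g : ℝ → ℝ} {g' s : ℝ} {S : Set ℝ}
    (hg : HasDerivWithinAt g g' S s) :
    HasDerivWithinAt (fun r => F (r, g r)) (dt F (s, g s) + dx F (s, g s) * g') S s := by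
  have h1 : HasFDerivAt F (fderiv ℝ F (s, g s)) (s, g s) :=
    (hF.differentiable one_ne_zero _).hasFDerivAt
  have h2 : HasDerivWithinAt (fun r : ℝ => (r, g r)) ((1 : ℝ), g') S s :=
    (hasDerivWithinAt_id s S).prodMk hg
  have h3 := h1.comp_hasDerivWithinAt s h2
  rw [dt_eq_fderiv hF, dx_eq_fderiv hF]
  have h4 : ((1 : ℝ), g') = (1, 0) + g' • ((0 : ℝ), (1 : ℝ)) := by simp
  rw [h4, map_add, map_smul, smul_eq_mul, mul_comm] at h3
  exact h3

theorem fderiv_eq_zero_of_partial (hF : ContDiff ℝ 1 F) {p : ℝ × ℝ} (h1 : dt F p = 0)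
    (h2 : dx F p = 0) : fderiv ℝ F p = 0 := by
  rw [dt_eq_fderiv hF] at h1
  rw [dx_eq_fderiv hF] at h2
  ext
  · simpa using h1
  · simpa using h2

theorem dt_comp_neg_time (p : ℝ × ℝ) :
    dt (fun p => F (-p.1, p.2)) p = -dt F (-p.1, p.2) :=
  deriv_comp_neg (fun s => F (s, p.2)) p.1

theorem dx_comp_neg_time (p : ℝ × ℝ) :
    dx (fun p => F (-p.1, p.2)) p = dx F (-p.1, p.2) := rfl

theorem dx_comp_neg_space (p : ℝ × ℝ) :
    dx (fun p => F (p.1, -p.2)) p = -dx F (p.1, -p.2) :=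
  deriv_comp_neg (fun s => F (p.1, s)) p.2

theorem dt_comp_neg_space (p : ℝ × ℝ) :
    dt (fun p => F (p.1, -p.2)) p = dt F (p.1, -p.2) := rfl

theorem dt_neg (p : ℝ × ℝ) : dt (fun p => -F p) p = -dt F p := deriv.fun_neg

theorem dx_neg (p : ℝ × ℝ) : dx (fun p => -F p) p = -dx F p := deriv.fun_neg

end Partial

/-! ### Periodic solutions and their symmetries -/

/-- `(U, V)` is a `C²` solution of the `p`-system on the plane that is `1`-periodic in space. -/
structure PeriodicFlow (σ : ℝ → ℝ) (U V : ℝ × ℝ → ℝ) : Prop where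
  smooth_σ : ContDiff ℝ 2 σ
  smooth_U : ContDiff ℝ 2 U
  smooth_V : ContDiff ℝ 2 V
  per_U : ∀ t x, U (t, x + 1) = U (t, x)
  per_V : ∀ t x, V (t, x + 1) = V (t, x)
  eq_U : ∀ p, dt U p = -dx V p
  eq_V : ∀ p, dt V p = deriv σ (U p) * dx U p

/-- The strictly hyperbolic, genuinely nonlinear half-line `u < α`. -/
structure Wing (σ : ℝ → ℝ) (α : ℝ) : Prop where
  neg : ∀ z, z < α → deriv σ z < 0
  zero : deriv σ α = 0
  conv : ∀ z, z ≤ α → 0 < deriv (deriv σ) z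

/-- The characteristic speed, set to `0` in the elliptic region. -/
noncomputable def speed (σ : ℝ → ℝ) (z : ℝ) : ℝ := √(-deriv σ z)

theorem deriv_odd_reflection (σ : ℝ → ℝ) : deriv (fun z => -σ (-z)) = fun z => deriv σ (-z) := by
  funext z
  rw [deriv.fun_neg, deriv_comp_neg, neg_neg]

theorem deriv_deriv_odd_reflection (σ : ℝ → ℝ) :
    deriv (deriv (fun z => -σ (-z))) = fun z => -deriv (deriv σ) (-z) := by
  funext z
  rw [deriv_odd_reflection, deriv_comp_neg]

namespace PeriodicFlow

variable {σ : ℝ → ℝ} {U V : ℝ × ℝ → ℝ}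

/-- The symmetries `reverse`, `reflect` and `negate` let the analysis treat only right-moving waves,
forward in time, in a lower half-line. -/
theorem reverse (h : PeriodicFlow σ U V) :
    PeriodicFlow σ (fun p => U (-p.1, p.2)) (fun p => -V (-p.1, p.2)) where
  smooth_σ := h.smooth_σ
  smooth_U := h.smooth_U.comp (contDiff_fst.neg.prodMk contDiff_snd)
  smooth_V := (h.smooth_V.comp (contDiff_fst.neg.prodMk contDiff_snd)).neg
  per_U t x := h.per_U _ _
  per_V t x := by simp [h.per_V]
  eq_U p := by
    rw [dt_comp_neg_time, dx_neg (F := fun p => V (-p.1, p.2)), dx_comp_neg_time, h.eq_U]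
  eq_V p := by
    rw [dt_neg (F := fun p => V (-p.1, p.2)), dt_comp_neg_time, dx_comp_neg_time, h.eq_V, neg_neg]

theorem reflect (h : PeriodicFlow σ U V) :
    PeriodicFlow σ (fun p => U (p.1, -p.2)) (fun p => -V (p.1, -p.2)) where
  smooth_σ := h.smooth_σ
  smooth_U := h.smooth_U.comp (contDiff_fst.prodMk contDiff_snd.neg)
  smooth_V := (h.smooth_V.comp (contDiff_fst.prodMk contDiff_snd.neg)).neg
  per_U t x := by
    have := h.per_U t (-(x + 1))
    simp only [neg_add_rev, neg_add_cancel_comm] at this ⊢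
    rw [← this]
  per_V t x := by
    have := h.per_V t (-(x + 1))
    simp only [neg_add_rev, neg_add_cancel_comm] at this ⊢
    rw [← this]
  eq_U p := by
    rw [dt_comp_neg_space, dx_neg (F := fun p => V (p.1, -p.2)), dx_comp_neg_space, h.eq_U, neg_neg]
  eq_V p := by
    rw [dt_neg (F := fun p => V (p.1, -p.2)), dt_comp_neg_space, dx_comp_neg_space, h.eq_V]
    ring

/-- Carries the upper hyperbolic half-line `u > β` of a cubic-like `σ` to the lower one `u < -β`. -/
theorem negate (h : PeriodicFlow σ U V) :
    PeriodicFlow (fun z => -σ (-z)) (fun p => -U p) (fun p => -V p) where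
  smooth_σ := (h.smooth_σ.comp contDiff_neg).neg
  smooth_U := h.smooth_U.neg
  smooth_V := h.smooth_V.neg
  per_U t x := by simp [h.per_U]
  per_V t x := by simp [h.per_V]
  eq_U p := by rw [dt_neg, dx_neg, h.eq_U]
  eq_V p := by
    rw [dt_neg, dx_neg, h.eq_V, deriv_odd_reflection]
    simp

theorem U1 (h : PeriodicFlow σ U V) : ContDiff ℝ 1 U := h.smooth_U.of_le (by norm_num)

theorem V1 (h : PeriodicFlow σ U V) : ContDiff ℝ 1 V := h.smooth_V.of_le (by norm_num)

theorem contU (h : PeriodicFlow σ U V) : Continuous U := h.smooth_U.continuous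

theorem smooth_dσ (h : PeriodicFlow σ U V) : ContDiff ℝ 1 (deriv σ) :=
  h.smooth_σ.deriv'

theorem cont_dσ (h : PeriodicFlow σ U V) : Continuous (deriv σ) := h.smooth_dσ.continuous

theorem cont_ddσ (h : PeriodicFlow σ U V) : Continuous (deriv (deriv σ)) :=
  h.smooth_dσ.continuous_deriv le_rfl

theorem hasDerivAt_dσ (h : PeriodicFlow σ U V) (z : ℝ) :
    HasDerivAt (deriv σ) (deriv (deriv σ) z) z :=
  (h.smooth_dσ.differentiable one_ne_zero z).hasDerivAt

theorem cont_speed (h : PeriodicFlow σ U V) : Continuous (speed σ) :=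
  h.cont_dσ.neg.sqrt

theorem hasDerivAt_dσU_space (h : PeriodicFlow σ U V) (t x : ℝ) :
    HasDerivAt (fun y => deriv σ (U (t, y))) (deriv (deriv σ) (U (t, x)) * dx U (t, x)) x :=
  HasDerivAt.comp (h := fun y => U (t, y)) x (h.hasDerivAt_dσ (U (t, x))) (hasDerivAt_dx h.U1 t x)

/-- The second-order equation for `u`. -/
theorem dt_dt (h : PeriodicFlow σ U V) (p : ℝ × ℝ) :
    dt (dt U) p =
      -(deriv (deriv σ) (U p) * dx U p ^ 2 + deriv σ (U p) * dx (dx U) p) := by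
  have h1 : dt U = fun p => -dx V p := funext h.eq_U
  have h2 : dt V = fun p => deriv σ (U p) * dx U p := funext h.eq_V
  rw [h1, dt_neg, dt_dx_comm h.smooth_V, h2]
  congr 1
  have := (h.hasDerivAt_dσU_space p.1 p.2).mul (hasDerivAt_dx (contDiff_dx h.smooth_U) p.1 p.2)
  rw [dx]
  refine this.deriv.trans ?_
  ring

theorem per_dt (h : PeriodicFlow σ U V) (t x : ℝ) : dt U (t, x + 1) = dt U (t, x) := by
  simp [dt, h.per_U]

theorem per_dx (h : PeriodicFlow σ U V) (t x : ℝ) : dx U (t, x + 1) = dx U (t, x) := by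
  have := deriv_comp_add_const (fun y => U (t, y)) 1 x
  simp only [h.per_U] at this
  exact this.symm

end PeriodicFlow

theorem Wing.speed_pos {σ : ℝ → ℝ} {α z : ℝ} (w : Wing σ α) (hz : z < α) : 0 < speed σ z :=
  Real.sqrt_pos.2 (by linarith [w.neg z hz])

theorem Wing.lt_of_speed_pos {σ : ℝ → ℝ} {α z : ℝ} (w : Wing σ α) (hz : z ≤ α)
    (hs : 0 < speed σ z) : z < α := by
  rcases hz.lt_or_eq with h | rfl
  · exact h
  · simp [speed, w.zero] at hs

theorem Wing.speed_sq {σ : ℝ → ℝ} {α z : ℝ} (w : Wing σ α) (hz : z ≤ α) :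
    speed σ z ^ 2 = -deriv σ z := by
  refine Real.sq_sqrt ?_
  rcases hz.lt_or_eq with h | rfl
  · linarith [w.neg z h]
  · simp [w.zero]

/-! ### Growth along characteristics -/

theorem exists_bound_of_periodic {F : ℝ × ℝ → ℝ} (hF : Continuous F)
    (hp : ∀ t x, F (t, x + 1) = F (t, x)) (a b : ℝ) :
    ∃ C, 0 < C ∧ ∀ t ∈ Icc a b, ∀ x, |F (t, x)| ≤ C := by
  obtain ⟨C, hC⟩ := (isCompact_Icc.prod isCompact_Icc).exists_bound_of_continuousOn
    (s := Icc a b ×ˢ Icc (0 : ℝ) 1) hF.continuousOn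
  refine ⟨max C 1, by positivity, fun t ht x => ?_⟩
  obtain ⟨y, hy, hxy⟩ := Function.Periodic.exists_mem_Ico₀ (f := fun x => F (t, x)) (hp t)
    one_pos x
  rw [hxy]
  exact (hC (t, y) ⟨ht, Ico_subset_Icc_self hy⟩).trans (le_max_left _ _)

/-- The space derivative of the Riemann invariant transported to the right. -/
noncomputable def rate (σ : ℝ → ℝ) (U : ℝ × ℝ → ℝ) (p : ℝ × ℝ) : ℝ :=
  -dt U p + speed σ (U p) * dx U p

/-- The quantity that satisfies a Riccati equation along right-moving characteristics. -/
noncomputable def wave (σ : ℝ → ℝ) (U : ℝ × ℝ → ℝ) (p : ℝ × ℝ) : ℝ :=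
  √(speed σ (U p)) * rate σ U p

/-- The coefficient of the Riccati equation. -/
noncomputable def gain (σ : ℝ → ℝ) (z : ℝ) : ℝ :=
  deriv (deriv σ) z / (4 * speed σ z ^ 2 * √(speed σ z))

/-- A right-moving characteristic in `u < α`, along which `wave` is at least `w₀`. -/
def IsCharacteristic (σ : ℝ → ℝ) (U : ℝ × ℝ → ℝ) (α w₀ a b : ℝ) (g : ℝ → ℝ) : Prop :=
  ∀ s ∈ Icc a b, HasDerivWithinAt g (speed σ (U (s, g s))) (Icc a b) s ∧ U (s, g s) < α ∧
    w₀ ≤ wave σ U (s, g s)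

theorem Wing.gain_pos {σ : ℝ → ℝ} {α z : ℝ} (w : Wing σ α) (hz : z < α) : 0 < gain σ z := by
  have h1 := w.conv z hz.le
  have h2 := w.speed_pos hz
  have h3 := Real.sqrt_pos.2 h2
  unfold gain
  positivity

namespace PeriodicFlow

variable {σ : ℝ → ℝ} {U V : ℝ × ℝ → ℝ} {α : ℝ}

theorem cont_rate (h : PeriodicFlow σ U V) : Continuous (rate σ U) :=
  (continuous_dt h.U1).neg.add ((h.cont_speed.comp h.contU).mul (continuous_dx h.U1))

theorem cont_wave (h : PeriodicFlow σ U V) : Continuous (wave σ U) :=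
  (h.cont_speed.comp h.contU).sqrt.mul h.cont_rate

theorem per_rate (h : PeriodicFlow σ U V) (t x : ℝ) : rate σ U (t, x + 1) = rate σ U (t, x) := by
  simp [rate, h.per_dt, h.per_dx, h.per_U]

/-- The Riccati equation of Lax. -/
theorem riccati (h : PeriodicFlow σ U V) (w : Wing σ α) {g : ℝ → ℝ} {s : ℝ} {S : Set ℝ}
    (hg : HasDerivWithinAt g (speed σ (U (s, g s))) S s) (hU : U (s, g s) < α) :
    HasDerivWithinAt (fun r => wave σ U (r, g r))
      (gain σ (U (s, g s)) * wave σ U (s, g s) ^ 2) S s := by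
  have hu := hasDerivWithinAt_along h.U1 hg
  have hut := hasDerivWithinAt_along (contDiff_dt h.smooth_U) hg
  have hux := hasDerivWithinAt_along (contDiff_dx h.smooth_U) hg
  have ha := ((h.hasDerivAt_dσ (U (s, g s))).comp_hasDerivWithinAt s hu).neg
  have hapos : 0 < -deriv σ (U (s, g s)) := by linarith [w.neg _ hU]
  have hl := ha.sqrt hapos.ne'
  have hlpos : 0 < √(-deriv σ (U (s, g s))) := Real.sqrt_pos.2 hapos
  have hm := hl.sqrt hlpos.ne'
  have hmpos : 0 < √(√(-deriv σ (U (s, g s)))) := Real.sqrt_pos.2 hlpos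
  have key := hm.mul (hut.neg.add (hl.mul hux))
  refine key.congr_deriv ?_
  simp only [gain, wave, rate, speed, Function.comp_def, Pi.neg_apply, Pi.add_apply, Pi.mul_apply]
  rw [h.dt_dt, dt_dx_comm h.smooth_U]
  -- In the variable `m = (-σ')^(1/4)` the identity is rational.
  have e1 : √(√(-deriv σ (U (s, g s)))) ^ 2 = √(-deriv σ (U (s, g s))) := Real.sq_sqrt hlpos.le
  have e2 : √(-deriv σ (U (s, g s))) ^ 2 = -deriv σ (U (s, g s)) := Real.sq_sqrt hapos.le
  have e3 : deriv σ (U (s, g s)) = -(√(√(-deriv σ (U (s, g s)))) ^ 2) ^ 2 := by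
    rw [e1, e2, neg_neg]
  rw [← e1]
  generalize √(√(-deriv σ (U (s, g s)))) = m at *
  rw [Real.sqrt_sq hmpos.le, e3]
  field_simp
  ring

/-- Characteristics along which `wave` is positive never leave the hyperbolic region. -/
theorem exists_isCharacteristic (h : PeriodicFlow σ U V) (w : Wing σ α) {t₀ x₀ T : ℝ}
    (hT : t₀ ≤ T) (hU : U (t₀, x₀) < α) (hw : 0 < rate σ U (t₀, x₀)) :
    ∃ g : ℝ → ℝ, g t₀ = x₀ ∧ IsCharacteristic σ U α (wave σ U (t₀, x₀)) t₀ T g := by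
  have hw0 : 0 < wave σ U (t₀, x₀) := mul_pos (Real.sqrt_pos.2 (w.speed_pos hU)) hw
  set w0 := wave σ U (t₀, x₀) with hw0def
  obtain ⟨C, hC0, hC⟩ := exists_bound_of_periodic h.cont_rate h.per_rate t₀ T
  -- As `|rate| ≤ C` on the time strip, `wave ≥ w0` forces `√λ ≥ w0 / C`: the sonic line stays at a
  -- distance.
  set m : ℝ := (w0 / C) ^ 2 with hm
  have hm0 : 0 < m := by positivity
  have hspeed : ∀ s ∈ Icc t₀ T, ∀ x, w0 ≤ wave σ U (s, x) → m ≤ speed σ (U (s, x)) := by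
    intro s hs x hx
    have h1 : wave σ U (s, x) ≤ √(speed σ (U (s, x))) * C :=
      mul_le_mul_of_nonneg_left ((le_abs_self _).trans (hC s hs x)) (Real.sqrt_nonneg _)
    have h2 : w0 / C ≤ √(speed σ (U (s, x))) := by
      rw [div_le_iff₀ hC0]; linarith
    calc m ≤ √(speed σ (U (s, x))) ^ 2 := by
          rw [hm]; gcongr
      _ = speed σ (U (s, x)) := Real.sq_sqrt (Real.sqrt_nonneg _)
  -- Flooring `-σ'` at `η` makes the field Lipschitz. It changes nothing where `λ ≥ m`, since `-σ' ≥
  -- m² > η` there; the strict gap leaves room for the continuation below.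
  set η : ℝ := m ^ 2 / 4 with hη
  have hη0 : 0 < η := by positivity
  let f : ℝ → ℝ → ℝ := fun t x => √(max (-deriv σ (U (t, x))) η)
  have hfc : Continuous (fun p : ℝ × ℝ => f p.1 p.2) :=
    (((h.cont_dσ.comp h.contU).neg).max continuous_const).sqrt
  obtain ⟨L, hL0, hL⟩ := exists_bound_of_periodic hfc
    (by intro t x; simp only [f, h.per_U]) t₀ T
  -- A field bounded by `L` cannot leave this interval before time `T`, so Picard–Lindelöf reaches
  -- `T` in one application.
  set a : ℝ := L * (T - t₀) with ha
  have ha0 : 0 ≤ a := mul_nonneg hL0.le (by linarith)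
  have hA : ContDiff ℝ 1 (fun p : ℝ × ℝ => deriv σ (U p)) := h.smooth_dσ.comp h.U1
  obtain ⟨K, hK⟩ := (isCompact_Icc.prod isCompact_Icc).exists_bound_of_continuousOn
    (s := Icc t₀ T ×ˢ Icc (x₀ - a) (x₀ + a)) (continuous_dx hA).continuousOn
  have hK' : ∀ t ∈ Icc t₀ T, ∀ x ∈ Icc (x₀ - a) (x₀ + a), ∀ y ∈ Icc (x₀ - a) (x₀ + a),
      |deriv σ (U (t, y)) - deriv σ (U (t, x))| ≤ K * |y - x| := by
    intro t ht x hx y hy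
    have := (convex_Icc (x₀ - a) (x₀ + a)).norm_image_sub_le_of_norm_hasDerivWithin_le
      (f := fun y => deriv σ (U (t, y))) (C := K)
      (fun z hz => (hasDerivAt_dx hA t z).hasDerivWithinAt) (fun z hz => hK (t, z) ⟨ht, hz⟩) hx hy
    simpa using this
  have hPL : IsPicardLindelof f (tmin := t₀) (tmax := T) ⟨t₀, left_mem_Icc.2 hT⟩ x₀ ⟨a, ha0⟩ 0
      ⟨L, hL0.le⟩ (Real.toNNReal (K / (2 * √η))) := by
    refine ⟨fun t ht => ?_, fun x _ => ?_, fun t ht x _ => ?_, ?_⟩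
    · refine LipschitzOnWith.of_dist_le_mul fun x hx y hy => ?_
      change x ∈ Metric.closedBall x₀ a at hx
      change y ∈ Metric.closedBall x₀ a at hy
      rw [Real.closedBall_eq_Icc] at hx hy
      have h1 := hK' t ht y hy x hx
      have hb : √η ≤ f t x := Real.sqrt_le_sqrt (le_max_right _ _)
      have hb' : √η ≤ f t y := Real.sqrt_le_sqrt (le_max_right _ _)
      have hη1 : 0 < √η := Real.sqrt_pos.2 hη0
      have h2 : |f t x ^ 2 - f t y ^ 2| ≤ K * |x - y| := by
        simp only [f]
        rw [Real.sq_sqrt (hη0.le.trans (le_max_right _ _)),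
          Real.sq_sqrt (hη0.le.trans (le_max_right _ _))]
        refine (abs_max_sub_max_le_abs _ _ _).trans ?_
        rw [neg_sub_neg, abs_sub_comm]
        exact h1
      rw [Real.dist_eq, Real.dist_eq]
      have h3 : |f t x ^ 2 - f t y ^ 2| = |f t x - f t y| * (f t x + f t y) := by
        rw [← abs_of_pos (a := f t x + f t y) (by linarith), ← abs_mul]; ring_nf
      have h4 : |f t x - f t y| * (2 * √η) ≤ K * |x - y| := by
        refine le_trans ?_ (h3 ▸ h2)
        gcongr
        linarith
      refine le_trans ?_ (mul_le_mul_of_nonneg_right (Real.le_coe_toNNReal _) (abs_nonneg _))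
      rw [div_mul_eq_mul_div, le_div_iff₀ (by positivity)]
      exact h4
    · exact (hfc.comp (continuous_id.prodMk continuous_const)).continuousOn
    · exact hL t ht x
    · change L * max (T - t₀) (t₀ - t₀) ≤ a - 0
      simp [ha, hT]
  obtain ⟨g, hg0, hg⟩ := hPL.exists_eq_forall_mem_Icc_hasDerivWithinAt₀
  simp only at hg0
  have hgc : ContinuousOn g (Icc t₀ T) := fun s hs => (hg s hs).continuousWithinAt
  have hgc' : ContinuousOn (fun s => (s, g s)) (Icc t₀ T) := continuousOn_id.prodMk hgc
  have hfeq : ∀ s x, η < -deriv σ (U (s, x)) → f s x = speed σ (U (s, x)) := by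
    intro s x hsx
    simp only [f, speed, max_eq_left hsx.le]
  have hgood : ∀ s ∈ Icc t₀ T, U (s, g s) ≤ α → w0 ≤ wave σ U (s, g s) →
      U (s, g s) < α ∧ η < -deriv σ (U (s, g s)) := by
    intro s hs h1 h2
    have h3 := hspeed s hs _ h2
    refine ⟨w.lt_of_speed_pos h1 (hm0.trans_le h3), ?_⟩
    rw [← w.speed_sq h1, hη]
    nlinarith [sq_nonneg (speed σ (U (s, g s)) - m)]
  -- Continuous induction: at a good time the strict bounds of `hgood` persist for a while, and
  -- meanwhile the Riccati equation keeps `wave` nondecreasing.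
  have hall : Icc t₀ T ⊆ {s | U (s, g s) ≤ α ∧ w0 ≤ wave σ U (s, g s)} := by
    refine IsClosed.Icc_subset_of_forall_exists_gt ?_ ?_ ?_
    · have h1 : IsClosed (Icc t₀ T ∩ (fun s => (s, g s)) ⁻¹' {p | U p ≤ α ∧ w0 ≤ wave σ U p}) :=
        hgc'.preimage_isClosed_of_isClosed isClosed_Icc
          ((isClosed_le h.contU continuous_const).inter
            (isClosed_le continuous_const h.cont_wave))
      rw [inter_comm] at h1
      exact h1
    · simp only [mem_ofPred_eq, hg0]
      exact ⟨hU.le, le_rfl⟩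
    · rintro s ⟨⟨h1, h2⟩, h3⟩ y hy
      have hs : s ∈ Icc t₀ T := Ico_subset_Icc_self h3
      obtain ⟨h4, h5⟩ := hgood s hs h1 h2
      have hopen : IsOpen {p : ℝ × ℝ | U p < α ∧ η < -deriv σ (U p)} :=
        (isOpen_lt h.contU continuous_const).inter
          (isOpen_lt continuous_const (h.cont_dσ.comp h.contU).neg)
      have hev : ∀ᶠ r in 𝓝[Icc t₀ T] s, U (r, g r) < α ∧ η < -deriv σ (U (r, g r)) :=
        (hgc' s hs).eventually_mem (hopen.mem_nhds ⟨h4, h5⟩)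
      obtain ⟨ε, hε, hball⟩ := Metric.mem_nhdsWithin_iff.1 hev
      set e : ℝ := min (min y T) (s + ε / 2) with he
      have hse : s < e := lt_min (lt_min hy h3.2) (by linarith)
      have heT : e ≤ T := (min_le_left _ _).trans (min_le_right _ _)
      have hey : e ≤ y := (min_le_left _ _).trans (min_le_left _ _)
      have heε : e ≤ s + ε / 2 := min_le_right _ _
      have hin : ∀ r ∈ Icc s e, U (r, g r) < α ∧ η < -deriv σ (U (r, g r)) := by
        intro r hr
        refine hball ⟨?_, hs.1.trans hr.1, hr.2.trans heT⟩
        rw [Metric.mem_ball, Real.dist_eq, abs_lt]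
        constructor <;> linarith [hr.1, hr.2]
      have hsub : Icc s e ⊆ Icc t₀ T := Icc_subset_Icc hs.1 heT
      have hder : ∀ r ∈ Icc s e, HasDerivWithinAt (fun r => wave σ U (r, g r))
          (gain σ (U (r, g r)) * wave σ U (r, g r) ^ 2) (Icc s e) r := by
        intro r hr
        have hgr := (hg r (hsub hr)).mono hsub
        rw [hfeq r (g r) (hin r hr).2] at hgr
        exact h.riccati w hgr (hin r hr).1
      have hmono : MonotoneOn (fun r => wave σ U (r, g r)) (Icc s e) := by
        refine monotoneOn_of_hasDerivWithinAt_nonneg (convex_Icc s e)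
          (fun r hr => (hder r hr).continuousWithinAt)
          (fun r hr => (hder r (interior_subset hr)).mono interior_subset) ?_
        intro r hr
        exact mul_nonneg (w.gain_pos (hin r (interior_subset hr)).1).le (sq_nonneg _)
      refine ⟨e, ⟨(hin e ⟨hse.le, le_rfl⟩).1.le, ?_⟩, hse, hey⟩
      exact h2.trans (hmono ⟨le_rfl, hse.le⟩ ⟨hse.le, le_rfl⟩ hse.le)
  refine ⟨g, hg0, fun s hs => ?_⟩
  obtain ⟨h1, h2⟩ := hall hs
  obtain ⟨h3, h4⟩ := hgood s hs h1 h2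
  have hgs := hg s hs
  rw [hfeq s (g s) h4] at hgs
  exact ⟨hgs, h3, h2⟩

end PeriodicFlow

namespace Wing

variable {σ : ℝ → ℝ} {α : ℝ}

theorem speed_antitone (w : Wing σ α) (hσ : ContDiff ℝ 2 σ) : AntitoneOn (speed σ) (Iic α) := by
  have hσ' : ContDiff ℝ 1 (deriv σ) := hσ.deriv'
  have h1 : MonotoneOn (deriv σ) (Iic α) := by
    refine monotoneOn_of_deriv_nonneg (convex_Iic α) hσ'.continuous.continuousOn
      (hσ'.differentiable one_ne_zero).differentiableOn ?_
    intro z hz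
    exact (w.conv z (interior_subset (s := Iic α) hz)).le
  intro y hy z hz hyz
  exact Real.sqrt_le_sqrt (neg_le_neg (h1 hy hz hyz))

/-- The numerator `σ''` has a positive minimum on `[m, α]`, and the denominator is largest at `m`
because the speed decreases towards `α`. -/
theorem exists_gain_bound (w : Wing σ α) (hσ : ContDiff ℝ 2 σ) (m : ℝ) :
    ∃ c, 0 < c ∧ ∀ z, m ≤ z → z < α → c ≤ gain σ z := by
  rcases lt_or_ge m α with hm | hm
  swap
  · exact ⟨1, one_pos, fun z h1 h2 => absurd (hm.trans h1) (not_le.2 h2)⟩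
  have hσ' : ContDiff ℝ 1 (deriv σ) := hσ.deriv'
  have hc : Continuous (deriv (deriv σ)) := hσ'.continuous_deriv le_rfl
  obtain ⟨y, hy, hmin⟩ := isCompact_Icc.exists_isMinOn (nonempty_Icc.2 hm.le)
    (hc.continuousOn (s := Icc m α))
  have h1 := w.conv y hy.2
  have h2 := w.speed_pos hm
  have h3 := Real.sqrt_pos.2 h2
  refine ⟨deriv (deriv σ) y / (4 * speed σ m ^ 2 * √(speed σ m)), by positivity, ?_⟩
  intro z hmz hz
  have h4 := w.speed_antitone hσ hm.le hz.le hmz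
  have h5 := w.speed_pos hz
  have h6 := Real.sqrt_pos.2 h5
  have h7 := w.conv z hz.le
  exact div_le_div₀ h7.le (hmin ⟨hmz, hz.le⟩) (by positivity) (by gcongr)

/-- Below `α - 1` the speed is at least `l`; above it the gain is at least `c`. A characteristic
thus always moves or steepens at a definite rate. -/
theorem exists_drift (w : Wing σ α) (hσ : ContDiff ℝ 2 σ) :
    ∃ l c, 0 < l ∧ 0 < c ∧ ∀ z, z < α → 1 ≤ speed σ z / l + gain σ z / c := by
  obtain ⟨c, hc, h⟩ := w.exists_gain_bound hσ (α - 1)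
  have hl : 0 < speed σ (α - 1) := w.speed_pos (by linarith)
  refine ⟨_, c, hl, hc, fun z hz => ?_⟩
  have h1 : 0 ≤ speed σ z / speed σ (α - 1) := div_nonneg (w.speed_pos hz).le hl.le
  have h2 : 0 ≤ gain σ z / c := div_nonneg (w.gain_pos hz).le hc.le
  rcases le_total (α - 1) z with h3 | h3
  · have : 1 ≤ gain σ z / c := (one_le_div hc).2 (h z h3 hz)
    linarith
  · have : 1 ≤ speed σ z / speed σ (α - 1) :=
      (one_le_div hl).2 (w.speed_antitone hσ hz.le (by simp) h3)
    linarith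

end Wing

namespace IsCharacteristic

variable {σ : ℝ → ℝ} {U V : ℝ × ℝ → ℝ} {α w₀ a b : ℝ} {g : ℝ → ℝ}

theorem mono {a' b' : ℝ} (hg : IsCharacteristic σ U α w₀ a b g) (ha : a ≤ a') (hb : b' ≤ b) :
    IsCharacteristic σ U α w₀ a' b' g := by
  intro s hs
  obtain ⟨h1, h2⟩ := hg s ⟨ha.trans hs.1, hs.2.trans hb⟩
  exact ⟨h1.mono (Icc_subset_Icc ha hb), h2⟩

theorem continuousOn (hg : IsCharacteristic σ U α w₀ a b g) : ContinuousOn g (Icc a b) :=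
  fun s hs => (hg s hs).1.continuousWithinAt

/-- The substitution `-1/y` linearises `y' = k y²`. -/
theorem hasDerivWithinAt_inv (hf : PeriodicFlow σ U V) (w : Wing σ α) (hw : 0 < w₀)
    (hg : IsCharacteristic σ U α w₀ a b g) {s : ℝ} (hs : s ∈ Icc a b) :
    HasDerivWithinAt (fun r => -(wave σ U (r, g r))⁻¹) (gain σ (U (s, g s))) (Icc a b) s := by
  obtain ⟨h1, h2, h3⟩ := hg s hs
  have h4 : wave σ U (s, g s) ≠ 0 := (hw.trans_le h3).ne'
  refine ((hf.riccati w h1 h2).inv h4).neg.congr_deriv ?_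
  field_simp

/-- Over a time that depends only on `w₀`, a characteristic goes once around the circle. -/
theorem exists_winding_time (hf : PeriodicFlow σ U V) (w : Wing σ α) (hw : 0 < w₀) :
    ∃ D, 0 < D ∧ ∀ a b g, IsCharacteristic σ U α w₀ a b g →
      ∀ r ∈ Icc a b, ∀ s ∈ Icc a b, r + D ≤ s → g r + 1 ≤ g s := by
  obtain ⟨l, c, hl, hc, hlc⟩ := w.exists_drift hf.smooth_σ
  -- `1 / l` pays for one turn; `1 / (c * w₀)` is the most that the increase of `-1/wave`, divided
  -- by `c`, can contribute.
  refine ⟨1 / l + 1 / (c * w₀), by positivity, fun a b g hg r hr s hs hrs => ?_⟩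
  have hD : 0 ≤ 1 / l + 1 / (c * w₀) := by positivity
  have hder : ∀ x ∈ Icc a b, HasDerivWithinAt
      (fun x => g x / l + -(wave σ U (x, g x))⁻¹ / c - x)
      (speed σ (U (x, g x)) / l + gain σ (U (x, g x)) / c - 1) (Icc a b) x := by
    intro x hx
    exact (((hg x hx).1.div_const l).add ((hg.hasDerivWithinAt_inv hf w hw hx).div_const c)).sub
      (hasDerivWithinAt_id x _)
  have hmono : MonotoneOn (fun x => g x / l + -(wave σ U (x, g x))⁻¹ / c - x) (Icc a b) := by
    refine monotoneOn_of_hasDerivWithinAt_nonneg (convex_Icc a b)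
      (fun x hx => (hder x hx).continuousWithinAt)
      (fun x hx => (hder x (interior_subset hx)).mono interior_subset) ?_
    intro x hx
    have := hlc _ (hg x (interior_subset hx)).2.1
    linarith
  have h1 := hmono hr hs (by linarith)
  simp only at h1
  have h2 : (wave σ U (r, g r))⁻¹ ≤ w₀⁻¹ := inv_anti₀ hw (hg r hr).2.2
  have h3 : 0 ≤ (wave σ U (s, g s))⁻¹ := inv_nonneg.2 (hw.le.trans (hg s hs).2.2)
  have h4 : (wave σ U (r, g r))⁻¹ / c ≤ 1 / (c * w₀) := by
    rw [div_le_iff₀ hc]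
    calc _ ≤ w₀⁻¹ := h2
      _ = _ := by field_simp
  have h5 : 0 ≤ (wave σ U (s, g s))⁻¹ / c := div_nonneg h3 hc.le
  rw [neg_div, neg_div] at h1
  have h6 : 1 / l ≤ (g s - g r) / l := by rw [sub_div]; linarith
  have h7 := (div_le_div_iff_of_pos_right hl).1 h6
  linarith

end IsCharacteristic

namespace PeriodicFlow

variable {σ : ℝ → ℝ} {U V : ℝ × ℝ → ℝ} {α : ℝ}

theorem wave_pos (w : Wing σ α) {p : ℝ × ℝ} (hU : U p < α) (hw : 0 < rate σ U p) :
    0 < wave σ U p :=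
  mul_pos (Real.sqrt_pos.2 (w.speed_pos hU)) hw

/-- Blow-up in finite time. -/
theorem rate_nonpos_of_bounded (h : PeriodicFlow σ U V) (w : Wing σ α) {t₀ m : ℝ}
    (hm : ∀ t, t₀ ≤ t → ∀ x, m ≤ U (t, x)) {t x : ℝ} (ht : t₀ ≤ t) (hU : U (t, x) < α) :
    rate σ U (t, x) ≤ 0 := by
  by_contra! hpos
  have hw0 := wave_pos w hU hpos
  set w₀ := wave σ U (t, x) with hw₀
  obtain ⟨c, hc, hgain⟩ := w.exists_gain_bound h.smooth_σ m
  -- `-1/wave` starts at or above `-1/w₀` and grows at rate at least `c`, so it would reach `0` by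
  -- this time although `wave` stays positive.
  obtain ⟨g, -, hg⟩ := h.exists_isCharacteristic w (T := t + 1 / (c * w₀))
    (by linarith [show 0 ≤ 1 / (c * w₀) by positivity]) hU hpos
  rw [← hw₀] at hg
  set T := t + 1 / (c * w₀) with hT
  have htT : t ≤ T := by linarith [show 0 ≤ 1 / (c * w₀) by positivity]
  have hder : ∀ s ∈ Icc t T, HasDerivWithinAt
      (fun s => -(wave σ U (s, g s))⁻¹ - c * s) (gain σ (U (s, g s)) - c * 1) (Icc t T) s :=
    fun s hs => (hg.hasDerivWithinAt_inv h w hw0 hs).sub ((hasDerivWithinAt_id s _).const_mul c)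
  have hmono : MonotoneOn (fun s => -(wave σ U (s, g s))⁻¹ - c * s) (Icc t T) := by
    refine monotoneOn_of_hasDerivWithinAt_nonneg (convex_Icc t T)
      (fun s hs => (hder s hs).continuousWithinAt)
      (fun s hs => (hder s (interior_subset hs)).mono interior_subset) ?_
    intro s hs
    have hs' := interior_subset hs
    linarith [hgain _ (hm s (ht.trans hs'.1) (g s)) (hg s hs').2.1]
  have h1 := hmono (left_mem_Icc.2 htT) (right_mem_Icc.2 htT) htT
  simp only at h1
  have h2 : (wave σ U (t, g t))⁻¹ ≤ w₀⁻¹ := inv_anti₀ hw0 (hg t (left_mem_Icc.2 htT)).2.2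
  have h3 : 0 < (wave σ U (T, g T))⁻¹ :=
    inv_pos.2 (hw0.trans_le (hg T (right_mem_Icc.2 htT)).2.2)
  have h4 : c * T = c * t + w₀⁻¹ := by rw [hT]; field_simp
  linarith

end PeriodicFlow

/-! ### Transport, Riemann invariants and lower bounds -/

/-- One-sided because the maximum over a time interval may sit at its final time. -/
theorem nonneg_of_max_left {f : ℝ → ℝ} {f' a s : ℝ} (has : a < s) (hf : HasDerivAt f f' s)
    (hmax : ∀ r ∈ Ioo a s, f r ≤ f s) : 0 ≤ f' := by
  have h1 : Tendsto (slope f s) (𝓝[<] s) (𝓝 f') :=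
    (hasDerivWithinAt_iff_tendsto_slope' (by simp)).1 hf.hasDerivWithinAt
  refine ge_of_tendsto h1 ?_
  filter_upwards [Ioo_mem_nhdsLT has] with r hr
  rw [slope_def_field]
  exact div_nonneg_of_nonpos (sub_nonpos.2 (hmax r hr)) (sub_nonpos.2 hr.2.le)

/-- The maximum principle for transport equations on a cylinder. -/
theorem le_of_transport {R c : ℝ × ℝ → ℝ} (hR : ContDiff ℝ 1 R)
    (hp : ∀ t x, R (t, x + 1) = R (t, x)) {t₀ M : ℝ}
    (heq : ∀ t, t₀ ≤ t → ∀ x, dt R (t, x) = c (t, x) * dx R (t, x))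
    (hM : ∀ x, R (t₀, x) ≤ M) {t x : ℝ} (ht : t₀ ≤ t) : R (t, x) ≤ M := by
  by_contra! hlt
  have htt : t₀ < t := by
    rcases ht.lt_or_eq with h | rfl
    · exact h
    · exact absurd (hM x) (not_le.2 hlt)
  -- The penalty `ε * (t - t₀)` uses up half of the excess over `M`, so the maximum is not at `t₀`;
  -- there `dx R = 0`, hence `dt R = 0`, against `dt R ≥ ε`.
  set ε := (R (t, x) - M) / (2 * (t - t₀)) with hε
  have hpos : 0 < t - t₀ := sub_pos.2 htt
  have hε0 : 0 < ε := div_pos (sub_pos.2 hlt) (by linarith)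
  have hεt : ε * (t - t₀) = (R (t, x) - M) / 2 := by rw [hε]; field_simp
  obtain ⟨⟨s, y⟩, hsy, hmax⟩ := (isCompact_Icc.prod isCompact_Icc).exists_isMaxOn
    (s := Icc t₀ t ×ˢ Icc (0 : ℝ) 1) (f := fun p => R p - ε * (p.1 - t₀))
    ⟨(t, 0), ⟨⟨ht, le_rfl⟩, by simp⟩⟩
    (by have := hR.continuous; fun_prop)
  have hmax' : ∀ r ∈ Icc t₀ t, ∀ z, R (r, z) - ε * (r - t₀) ≤ R (s, y) - ε * (s - t₀) := by
    intro r hr z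
    obtain ⟨z', hz', hzz⟩ := Function.Periodic.exists_mem_Ico₀ (f := fun x => R (r, x)) (hp r)
      one_pos z
    rw [hzz]
    exact hmax (a := (r, z')) ⟨hr, Ico_subset_Icc_self hz'⟩
  have hs : t₀ < s := by
    rcases hsy.1.1.lt_or_eq with h | h
    · exact h
    · simp only at h
      have h1 := hmax' t ⟨ht, le_rfl⟩ x
      subst h
      have h2 := hM y
      simp only [sub_self, mul_zero, sub_zero] at h1
      linarith
  have hx0 : dx R (s, y) = 0 := by
    have : IsLocalMax (fun z => R (s, z)) y :=
      Filter.Eventually.of_forall fun z => by linarith [hmax' s hsy.1 z]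
    exact this.deriv_eq_zero
  have h1 : HasDerivAt (fun r => R (r, y) - ε * (r - t₀)) (dt R (s, y) - ε * 1) s :=
    (hasDerivAt_dt hR s y).sub (((hasDerivAt_id s).sub_const t₀).const_mul ε)
  have h2 := nonneg_of_max_left hs h1
    (fun r hr => hmax' r ⟨hr.1.le, hr.2.le.trans hsy.1.2⟩ y)
  rw [heq s hs.le, hx0] at h2
  linarith

namespace PeriodicFlow

variable {σ : ℝ → ℝ} {U V : ℝ × ℝ → ℝ} {α : ℝ}

/-- With `Λ' = λ`, the Riemann invariants `v ± Λ(u)` are transported while `u ≤ α`. Upper bounds for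
`-(v + Λ)` and `v - Λ` add up to a lower bound for `Λ(u)`, and `Λ` tends to `-∞` at least linearly
at `-∞`. -/
theorem exists_lower_bound (h : PeriodicFlow σ U V) (w : Wing σ α) {t₀ : ℝ}
    (hα : ∀ t, t₀ ≤ t → ∀ x, U (t, x) ≤ α) : ∃ m, ∀ t, t₀ ≤ t → ∀ x, m ≤ U (t, x) := by
  set Λ : ℝ → ℝ := fun z => ∫ s in α..z, speed σ s with hΛ
  have hΛd : ∀ z, HasDerivAt Λ (speed σ z) z := fun z =>
    intervalIntegral.integral_hasDerivAt_right (h.cont_speed.intervalIntegrable _ _)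
      (h.cont_speed.stronglyMeasurableAtFilter _ _) h.cont_speed.continuousAt
  have hΛ1 : ContDiff ℝ 1 Λ := by
    rw [contDiff_one_iff_deriv]
    refine ⟨fun z => (hΛd z).differentiableAt, ?_⟩
    rw [show deriv Λ = speed σ from funext fun z => (hΛd z).deriv]
    exact h.cont_speed
  have hPt : ∀ t x, HasDerivAt (fun s => Λ (U (s, x))) (speed σ (U (t, x)) * dt U (t, x)) t :=
    fun t x => HasDerivAt.comp (h := fun s => U (s, x)) t (hΛd (U (t, x))) (hasDerivAt_dt h.U1 t x)
  have hPx : ∀ t x, HasDerivAt (fun y => Λ (U (t, y))) (speed σ (U (t, x)) * dx U (t, x)) x :=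
    fun t x => HasDerivAt.comp (h := fun y => U (t, y)) x (hΛd (U (t, x))) (hasDerivAt_dx h.U1 t x)
  have hVt := hasDerivAt_dt h.V1
  have hVx := hasDerivAt_dx h.V1
  set P : ℝ × ℝ → ℝ := fun p => -(V p + Λ (U p)) with hP
  set Q : ℝ × ℝ → ℝ := fun p => V p - Λ (U p) with hQ
  have hP1 : ContDiff ℝ 1 P := (h.V1.add (hΛ1.comp h.U1)).neg
  have hQ1 : ContDiff ℝ 1 Q := h.V1.sub (hΛ1.comp h.U1)
  have hPp : ∀ t x, P (t, x + 1) = P (t, x) := fun t x => by simp [hP, h.per_U, h.per_V]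
  have hQp : ∀ t x, Q (t, x + 1) = Q (t, x) := fun t x => by simp [hQ, h.per_U, h.per_V]
  obtain ⟨C, hC, hPC⟩ := exists_bound_of_periodic hP1.continuous hPp t₀ t₀
  obtain ⟨C', hC', hQC⟩ := exists_bound_of_periodic hQ1.continuous hQp t₀ t₀
  have ht₀ : t₀ ∈ Icc t₀ t₀ := by simp
  have hPle : ∀ t, t₀ ≤ t → ∀ x, P (t, x) ≤ C := by
    intro t ht x
    refine le_of_transport (c := fun p => -speed σ (U p)) hP1 hPp ?_
      (fun x => (le_abs_self _).trans (hPC t₀ ht₀ x)) ht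
    intro t ht x
    have e1 : dt P (t, x) = -(dt V (t, x) + speed σ (U (t, x)) * dt U (t, x)) :=
      ((hVt t x).add (hPt t x)).neg.deriv
    have e2 : dx P (t, x) = -(dx V (t, x) + speed σ (U (t, x)) * dx U (t, x)) :=
      ((hVx t x).add (hPx t x)).neg.deriv
    have e3 := w.speed_sq (hα t ht x)
    rw [e1, e2, h.eq_V, h.eq_U]
    linear_combination (-dx U (t, x)) * e3
  have hQle : ∀ t, t₀ ≤ t → ∀ x, Q (t, x) ≤ C' := by
    intro t ht x
    refine le_of_transport (c := fun p => speed σ (U p)) hQ1 hQp ?_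
      (fun x => (le_abs_self _).trans (hQC t₀ ht₀ x)) ht
    intro t ht x
    have e1 : dt Q (t, x) = dt V (t, x) - speed σ (U (t, x)) * dt U (t, x) :=
      ((hVt t x).sub (hPt t x)).deriv
    have e2 : dx Q (t, x) = dx V (t, x) - speed σ (U (t, x)) * dx U (t, x) :=
      ((hVx t x).sub (hPx t x)).deriv
    have e3 := w.speed_sq (hα t ht x)
    rw [e1, e2, h.eq_V, h.eq_U]
    linear_combination dx U (t, x) * e3
  have hΛle : ∀ t, t₀ ≤ t → ∀ x, -(C + C') / 2 ≤ Λ (U (t, x)) := by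
    intro t ht x
    have h1 := hPle t ht x
    have h2 := hQle t ht x
    simp only [hP, hQ] at h1 h2
    linarith
  set l := speed σ (α - 1) with hl
  have hl0 : 0 < l := w.speed_pos (by linarith)
  have hmono : MonotoneOn (fun z => Λ z - l * z) (Iic (α - 1)) := by
    refine monotoneOn_of_hasDerivWithinAt_nonneg (convex_Iic _)
      (fun z hz => (((hΛd z).sub ((hasDerivAt_id z).const_mul l)).continuousAt).continuousWithinAt)
      (fun z hz => ((hΛd z).sub ((hasDerivAt_id z).const_mul l)).hasDerivWithinAt) ?_
    intro z hz
    have hz' : z ∈ Iic (α - 1) := interior_subset hz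
    rw [mem_Iic] at hz'
    have := w.speed_antitone h.smooth_σ (by simp only [mem_Iic]; linarith) (by simp) hz'
    linarith
  refine ⟨min (α - 1) ((-(C + C') / 2 - Λ (α - 1) + l * (α - 1)) / l), fun t ht x => ?_⟩
  rcases le_total (U (t, x)) (α - 1) with h1 | h1
  · refine (min_le_right _ _).trans ?_
    rw [div_le_iff₀ hl0]
    have := hmono h1 (by simp) h1
    simp only at this
    linarith [hΛle t ht x]
  · exact (min_le_left _ _).trans h1

theorem rate_nonpos_of_le (h : PeriodicFlow σ U V) (w : Wing σ α) {t₀ : ℝ}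
    (hα : ∀ t, t₀ ≤ t → ∀ x, U (t, x) ≤ α) {t x : ℝ} (ht : t₀ ≤ t) (hU : U (t, x) < α) :
    rate σ U (t, x) ≤ 0 := by
  obtain ⟨m, hm⟩ := h.exists_lower_bound w hα
  exact h.rate_nonpos_of_bounded w hm ht hU

end PeriodicFlow

/-! ### Second-derivative test and stationary points -/

/-- If `f₂ > 0`, the point would also be a local minimum, so `f` would be locally constant and `f₂ =
0`. -/
theorem nonpos_of_isLocalMax {f f₁ : ℝ → ℝ} {f₂ s : ℝ} (h1 : ∀ r, HasDerivAt f (f₁ r) r)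
    (h2 : HasDerivAt f₁ f₂ s) (hmax : IsLocalMax f s) : f₂ ≤ 0 := by
  by_contra! hpos
  have hd : deriv f = f₁ := funext fun r => (h1 r).deriv
  have hmin : IsLocalMin f s :=
    isLocalMin_of_deriv_deriv_pos (by rw [hd, h2.deriv]; exact hpos) hmax.deriv_eq_zero
      (h1 s).continuousAt
  have hconst : f =ᶠ[𝓝 s] fun _ => f s := by
    filter_upwards [hmin, hmax] with r h3 h4
    exact le_antisymm h4 h3
  have h3 : deriv f =ᶠ[𝓝 s] deriv fun _ => f s := hconst.deriv
  have h4 := h3.deriv_eq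
  rw [hd, h2.deriv] at h4
  simp at h4
  linarith

/-- A function that is stationary wherever it exceeds `β` cannot descend from above `β`. -/
theorem lt_of_stationary_above {f : ℝ → ℝ} {x y β : ℝ} (hxy : x ≤ y)
    (hf : Differentiable ℝ f) (h0 : ∀ z ∈ Icc x y, β < f z → deriv f z = 0) (hx : β < f x) :
    β < f y := by
  have hsub : Icc x y ⊆ {z | f z = f x} := by
    refine IsClosed.Icc_subset_of_forall_exists_gt ?_ rfl ?_
    · exact (isClosed_eq hf.continuous continuous_const).inter isClosed_Icc
    · rintro z ⟨hz, hzI⟩ y' hy'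
      have hz' : f z = f x := hz
      have hev : ∀ᶠ r in 𝓝 z, β < f r :=
        hf.continuous.continuousAt.eventually_mem (isOpen_Ioi.mem_nhds (by
          rw [mem_Ioi, hz']; exact hx))
      obtain ⟨ε, hε, hball⟩ := Metric.eventually_nhds_iff.1 hev
      set e := min (min y' y) (z + ε / 2) with he
      have h1 : z < e := lt_min (lt_min hy' hzI.2) (by linarith)
      have h2 : e ≤ y' := (min_le_left _ _).trans (min_le_left _ _)
      have h3 : e ≤ y := (min_le_left _ _).trans (min_le_right _ _)
      have h4 : e ≤ z + ε / 2 := min_le_right _ _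
      have hconst := constant_of_has_deriv_right_zero (f := f) (a := z) (b := e)
        hf.continuous.continuousOn (fun r hr => by
          have h5 : deriv f r = 0 := by
            refine h0 r ⟨hzI.1.trans hr.1, hr.2.le.trans h3⟩ (hball ?_)
            rw [Real.dist_eq, abs_lt]
            constructor <;> linarith [hr.1, hr.2]
          have h6 := (hf r).hasDerivAt.hasDerivWithinAt (s := Ici r)
          rwa [h5] at h6)
      exact ⟨e, (hconst e ⟨h1.le, le_rfl⟩).trans hz', h1, h2⟩
  have h1 : f y = f x := hsub ⟨hxy, le_rfl⟩
  rwa [h1]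

/-- A map whose derivative vanishes wherever its value lies in an open set is constant as soon
as it takes one value there. -/
theorem eq_of_stationary_on {F : ℝ × ℝ → ℝ} (hF : ContDiff ℝ 1 F) {J : Set ℝ}
    (hJ : IsOpen J) (h0 : ∀ p, F p ∈ J → dt F p = 0 ∧ dx F p = 0) {p : ℝ × ℝ} (hp : F p ∈ J)
    (q : ℝ × ℝ) : F q = F p := by
  have hclopen : IsClopen {q | F q = F p} := by
    refine ⟨isClosed_eq hF.continuous continuous_const, Metric.isOpen_iff.2 fun q hq => ?_⟩
    have hq' : F q ∈ J := by rw [show F q = F p from hq]; exact hp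
    obtain ⟨ε, hε, hball⟩ := Metric.isOpen_iff.1 (hJ.preimage hF.continuous) q hq'
    refine ⟨ε, hε, fun r hr => ?_⟩
    have h1 : F r = F q := by
      refine Metric.isOpen_ball.is_const_of_fderiv_eq_zero (𝕜 := ℝ)
        (convex_ball q ε).isPreconnected (hF.differentiable one_ne_zero).differentiableOn ?_ hr
        (Metric.mem_ball_self hε)
      intro z hz
      obtain ⟨h2, h3⟩ := h0 z (hball hz)
      exact fderiv_eq_zero_of_partial hF h2 h3
    exact h1.trans hq
  have := hclopen.eq_univ ⟨p, rfl⟩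
  exact this.ge (mem_univ q)

theorem rate_reflect (σ : ℝ → ℝ) (U : ℝ × ℝ → ℝ) (t x : ℝ) :
    rate σ (fun p => U (p.1, -p.2)) (t, -x) = -dt U (t, x) - speed σ (U (t, x)) * dx U (t, x) := by
  rw [rate, dt_comp_neg_space, dx_comp_neg_space]
  simp only [neg_neg]
  ring

theorem rate_reverse (σ : ℝ → ℝ) (U : ℝ × ℝ → ℝ) (t x : ℝ) :
    rate σ (fun p => U (-p.1, p.2)) (-t, x) = dt U (t, x) + speed σ (U (t, x)) * dx U (t, x) := by
  rw [rate, dt_comp_neg_time, dx_comp_neg_time]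
  simp only [neg_neg]

theorem rate_reverse_reflect (σ : ℝ → ℝ) (U : ℝ × ℝ → ℝ) (t x : ℝ) :
    rate σ (fun p => U (-p.1, -p.2)) (-t, -x) =
      dt U (t, x) - speed σ (U (t, x)) * dx U (t, x) := by
  rw [rate_reflect σ (fun p => U (-p.1, p.2)), dt_comp_neg_time, dx_comp_neg_time]
  simp only [neg_neg]

/-- A point is stationary when the rates of the flow and of its mirror images are nonpositive. -/
theorem Wing.stationary {σ : ℝ → ℝ} {U : ℝ × ℝ → ℝ} {α t x : ℝ} (w : Wing σ α)
    (hU : U (t, x) < α) (h1 : rate σ U (t, x) ≤ 0)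
    (h2 : rate σ (fun p => U (p.1, -p.2)) (t, -x) ≤ 0)
    (h3 : rate σ (fun p => U (-p.1, p.2)) (-t, x) ≤ 0)
    (h4 : rate σ (fun p => U (-p.1, -p.2)) (-t, -x) ≤ 0) :
    dt U (t, x) = 0 ∧ dx U (t, x) = 0 := by
  rw [rate] at h1
  rw [rate_reflect] at h2
  rw [rate_reverse] at h3
  rw [rate_reverse_reflect] at h4
  have hs := w.speed_pos hU
  refine ⟨by linarith, ?_⟩
  have : speed σ (U (t, x)) * dx U (t, x) = 0 := by linarith
  exact (mul_eq_zero.1 this).resolve_left hs.ne'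

/-! ### Trapped regions and the maximum principle in cells -/

/-- The values above `α` are elliptic, up to a second hyperbolic half-line if there is one. -/
def EllipticBeyond (σ : ℝ → ℝ) (α : ℝ) : Prop :=
  (∀ z, α ≤ z → 0 ≤ deriv σ z) ∨
    ∃ β, α < β ∧ Wing (fun z => -σ (-z)) (-β) ∧ ∀ z, α ≤ z → z ≤ β → 0 ≤ deriv σ z

namespace PeriodicFlow

variable {σ : ℝ → ℝ} {U V : ℝ × ℝ → ℝ} {α : ℝ}

/-- A region closed off in the future traps the hyperbolic points inside it. -/
theorem rate_nonpos_of_trapped (h : PeriodicFlow σ U V) (w : Wing σ α) {L R : ℝ → ℝ} {a b : ℝ}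
    (hL : Continuous L) (hR : Continuous R) (hUL : ∀ s ∈ Icc a b, α ≤ U (s, L s))
    (hUR : ∀ s ∈ Icc a b, α ≤ U (s, R s)) (hb : R b ≤ L b) {t x : ℝ} (ht : t ∈ Icc a b)
    (hx : x ∈ Icc (L t) (R t)) (hU : U (t, x) < α) : rate σ U (t, x) ≤ 0 := by
  by_contra! hpos
  -- The characteristic stays in `U < α`, so it cannot cross `L` or `R`; at time `b` no room is left
  -- between them.
  obtain ⟨g, hg0, hg⟩ := h.exists_isCharacteristic w ht.2 hU hpos
  have hgL : ∀ s ∈ Icc t b, g s ≠ L s := fun s hs he => by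
    have h1 := hUL s ⟨ht.1.trans hs.1, hs.2⟩
    rw [← he] at h1
    exact absurd (hg s hs).2.1 (not_lt.2 h1)
  have hgR : ∀ s ∈ Icc t b, g s ≠ R s := fun s hs he => by
    have h1 := hUR s ⟨ht.1.trans hs.1, hs.2⟩
    rw [← he] at h1
    exact absurd (hg s hs).2.1 (not_lt.2 h1)
  have htb : t ∈ Icc t b := ⟨le_rfl, ht.2⟩
  have hbb : b ∈ Icc t b := ⟨ht.2, le_rfl⟩
  have h1 : L b < g b := by
    by_contra! hle
    obtain ⟨s, hs, hs0⟩ := isPreconnected_Icc.intermediate_value₂ hbb htb hg.continuousOn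
      hL.continuousOn hle (by rw [hg0]; exact hx.1)
    exact hgL s hs hs0
  have h2 : g b < R b := by
    by_contra! hle
    obtain ⟨s, hs, hs0⟩ := isPreconnected_Icc.intermediate_value₂ htb hbb hg.continuousOn
      hR.continuousOn (by rw [hg0]; exact hx.2) hle
    exact hgR s hs hs0
  linarith

end PeriodicFlow

/-- A region between two curves that meet in the past and in the future, on whose boundary
`U < α`. -/
structure Cell (U : ℝ × ℝ → ℝ) (α a b : ℝ) (L R : ℝ → ℝ) : Prop where
  contL : Continuous L
  contR : Continuous R
  ltL : ∀ s ∈ Icc a b, U (s, L s) < α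
  ltR : ∀ s ∈ Icc a b, U (s, R s) < α
  closed_past : R a ≤ L a
  closed_future : R b ≤ L b

namespace Cell

variable {σ : ℝ → ℝ} {U V : ℝ × ℝ → ℝ} {α a b : ℝ} {L R : ℝ → ℝ}

/-- After negation the cell boundary is a barrier for waves in `U > β`. The cell closes in the past
and in the future, so the trapping argument applies to all four mirror images. -/
theorem stationary_above (c : Cell U α a b L R) (h : PeriodicFlow σ U V) {β : ℝ} (hαβ : α < β)
    (w : Wing (fun z => -σ (-z)) (-β)) {t x : ℝ} (ht : t ∈ Icc a b)
    (hx : x ∈ Icc (L t) (R t)) (hU : β < U (t, x)) : dx U (t, x) = 0 := by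
  have ht' : -t ∈ Icc (-b) (-a) := ⟨neg_le_neg ht.2, neg_le_neg ht.1⟩
  have hx' : -x ∈ Icc (-R t) (-L t) := ⟨neg_le_neg hx.2, neg_le_neg hx.1⟩
  have hneg : ∀ s ∈ Icc (-b) (-a), -s ∈ Icc a b := fun s hs =>
    ⟨le_neg_of_le_neg hs.2, neg_le_of_neg_le hs.1⟩
  have hL : ∀ s ∈ Icc a b, -β ≤ -U (s, L s) := fun s hs => by linarith [c.ltL s hs]
  have hR : ∀ s ∈ Icc a b, -β ≤ -U (s, R s) := fun s hs => by linarith [c.ltR s hs]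
  have hU' : -U (t, x) < -β := neg_lt_neg hU
  have h1 := h.negate.rate_nonpos_of_trapped w c.contL c.contR hL hR c.closed_future ht hx hU'
  have h2 := h.negate.reflect.rate_nonpos_of_trapped w (L := fun s => -R s) (R := fun s => -L s)
    c.contR.neg c.contL.neg (a := a) (b := b)
    (fun s hs => by simpa only [neg_neg] using hR s hs)
    (fun s hs => by simpa only [neg_neg] using hL s hs) (neg_le_neg c.closed_future) ht hx'
    (by simpa only [neg_neg] using hU')
  have h3 := h.negate.reverse.rate_nonpos_of_trapped w (L := fun s => L (-s))
    (R := fun s => R (-s)) (c.contL.comp continuous_neg) (c.contR.comp continuous_neg)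
    (fun s hs => hL _ (hneg s hs)) (fun s hs => hR _ (hneg s hs))
    (by simpa only [neg_neg] using c.closed_past) ht' (x := x) (by simpa only [neg_neg] using hx)
    (by simpa only [neg_neg] using hU')
  have h4 := h.negate.reverse.reflect.rate_nonpos_of_trapped w (L := fun s => -R (-s))
    (R := fun s => -L (-s)) (c.contR.comp continuous_neg).neg (c.contL.comp continuous_neg).neg
    (fun s hs => by simpa only [neg_neg] using hR _ (hneg s hs))
    (fun s hs => by simpa only [neg_neg] using hL _ (hneg s hs))
    (by simpa only [neg_neg] using neg_le_neg c.closed_past) ht' (x := -x)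
    (by simpa only [neg_neg] using hx')
    (by simpa only [neg_neg] using hU')
  have h5 := (w.stationary (U := fun p => -U p) hU' h1 h2 h3 h4).2
  rw [dx_neg] at h5
  linarith

/-- A slice that exceeds `β` would stay above `β` as far as `R`, where `U < α`. -/
theorem le_upper (c : Cell U α a b L R) (h : PeriodicFlow σ U V) {β : ℝ} (hαβ : α < β)
    (w : Wing (fun z => -σ (-z)) (-β)) {t x : ℝ} (ht : t ∈ Icc a b)
    (hx : x ∈ Icc (L t) (R t)) : U (t, x) ≤ β := by
  by_contra! hlt
  have := lt_of_stationary_above (f := fun y => U (t, y)) hx.2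
    (fun y => (hasDerivAt_dx h.U1 t y).differentiableAt)
    (fun z hz hβ => c.stationary_above h hαβ w ht ⟨hx.1.trans hz.1, hz.2⟩ hβ) hlt
  linarith [c.ltR t ht]

/-- The maximum principle in the elliptic region. -/
theorem le_of_elliptic (c : Cell U α a b L R) (h : PeriodicFlow σ U V)
    (hell : ∀ t ∈ Icc a b, ∀ x ∈ Icc (L t) (R t), α ≤ U (t, x) → 0 ≤ deriv σ (U (t, x)))
    {t x : ℝ} (ht : t ∈ Icc a b) (hx : x ∈ Icc (L t) (R t)) : U (t, x) ≤ α := by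
  by_contra! hlt
  set K : Set (ℝ × ℝ) := {p | p.1 ∈ Icc a b ∧ p.2 ∈ Icc (L p.1) (R p.1)} with hK
  obtain ⟨B, hB⟩ := (isCompact_Icc (a := a) (b := b)).exists_bound_of_continuousOn
    c.contL.continuousOn
  obtain ⟨B', hB'⟩ := (isCompact_Icc (a := a) (b := b)).exists_bound_of_continuousOn
    c.contR.continuousOn
  have hcL := c.contL
  have hcR := c.contR
  have hcU := h.contU
  have hKc : IsCompact K := by
    refine (isCompact_Icc.prod isCompact_Icc).of_isClosed_subset
      (s := Icc a b ×ˢ Icc (-B) B') ?_ ?_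
    · refine (isClosed_Icc.preimage continuous_fst).inter ?_
      exact (isClosed_le (by fun_prop) continuous_snd).inter
        (isClosed_le continuous_snd (by fun_prop))
    · rintro ⟨s, y⟩ ⟨hs, hy⟩
      refine ⟨hs, (neg_le_of_abs_le (hB s hs)).trans hy.1, hy.2.trans (le_of_abs_le (hB' s hs))⟩
  set N : ℝ := (|a| + |b|) ^ 2 + 1 with hN
  have hN0 : 0 < N := by positivity
  have hsN : ∀ s ∈ Icc a b, s ^ 2 ≤ N := by
    intro s hs
    have h1 : |s| ≤ |a| + |b| := by
      rw [abs_le]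
      constructor
      · linarith [neg_abs_le a, abs_nonneg b, hs.1]
      · linarith [le_abs_self b, abs_nonneg a, hs.2]
    have h2 : |s| ^ 2 ≤ (|a| + |b|) ^ 2 := by gcongr
    rw [sq_abs] at h2
    linarith
  -- The term `ε t²` makes the degenerate maximum principle strict; since `t² ≤ N`, it costs at most
  -- half of the excess over `α`.
  set ε : ℝ := (U (t, x) - α) / (2 * N) with hε
  have hε0 : 0 < ε := div_pos (sub_pos.2 hlt) (by linarith)
  have hεN : ε * N = (U (t, x) - α) / 2 := by rw [hε]; field_simp
  obtain ⟨⟨s, y⟩, hsy, hmax⟩ := hKc.exists_isMaxOn (f := fun p => U p + ε * p.1 ^ 2)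
    ⟨(t, x), ht, hx⟩ (by fun_prop)
  have hUq : α < U (s, y) := by
    have h1 := hmax (a := (t, x)) ⟨ht, hx⟩
    simp only [mem_ofPred_eq] at h1
    have h2 := mul_le_mul_of_nonneg_left (hsN s hsy.1) hε0.le
    have h3 : 0 ≤ ε * t ^ 2 := by positivity
    linarith
  have hyL : L s < y := by
    rcases hsy.2.1.lt_or_eq with h1 | h1
    · exact h1
    · have := c.ltL s hsy.1
      simp only at h1
      rw [h1] at this
      linarith
  have hyR : y < R s := by
    rcases hsy.2.2.lt_or_eq with h1 | h1
    · exact h1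
    · have := c.ltR s hsy.1
      simp only at h1
      rw [← h1] at this
      linarith
  have hsa : a < s := by
    rcases hsy.1.1.lt_or_eq with h1 | h1
    · exact h1
    · simp only at h1
      subst h1
      linarith [c.closed_past]
  have hsb : s < b := by
    rcases hsy.1.2.lt_or_eq with h1 | h1
    · exact h1
    · simp only at h1
      subst h1
      linarith [c.closed_future]
  have hopen : IsOpen {p : ℝ × ℝ | (a < p.1 ∧ p.1 < b) ∧ L p.1 < p.2 ∧ p.2 < R p.1} := by
    refine IsOpen.inter ?_ ?_
    · exact (isOpen_lt continuous_const continuous_fst).inter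
        (isOpen_lt continuous_fst continuous_const)
    · exact (isOpen_lt (by fun_prop) continuous_snd).inter (isOpen_lt continuous_snd (by fun_prop))
  have hloc : IsLocalMax (fun p : ℝ × ℝ => U p + ε * p.1 ^ 2) (s, y) := by
    filter_upwards [hopen.mem_nhds (x := (s, y)) ⟨⟨hsa, hsb⟩, hyL, hyR⟩] with p hp
    exact hmax ⟨⟨hp.1.1.le, hp.1.2.le⟩, hp.2.1.le, hp.2.2.le⟩
  have hloct : IsLocalMax (fun r => U (r, y) + ε * r ^ 2) s :=
    (show Continuous fun r : ℝ => (r, y) by fun_prop).continuousAt.eventually hloc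
  have hlocx : IsLocalMax (fun z => U (s, z)) y := by
    have h1 : ∀ᶠ z in 𝓝 y, U (s, z) + ε * s ^ 2 ≤ U (s, y) + ε * s ^ 2 :=
      (show Continuous fun z : ℝ => (s, z) by fun_prop).continuousAt.eventually hloc
    filter_upwards [h1] with z hz
    linarith
  have hx1 : dx U (s, y) = 0 := hlocx.deriv_eq_zero
  have hxx : dx (dx U) (s, y) ≤ 0 :=
    nonpos_of_isLocalMax (hasDerivAt_dx h.U1 s) (hasDerivAt_dx (contDiff_dx h.smooth_U) s y) hlocx
  have htt : dt (dt U) (s, y) + ε * 2 ≤ 0 := by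
    refine nonpos_of_isLocalMax (f₁ := fun r => dt U (r, y) + ε * (2 * r)) (fun r => ?_) ?_ hloct
    · exact ((hasDerivAt_dt h.U1 r y).add ((hasDerivAt_pow 2 r).const_mul ε)).congr_deriv
        (by norm_num)
    · exact ((hasDerivAt_dt (contDiff_dt h.smooth_U) s y).add
        (((hasDerivAt_id s).const_mul 2).const_mul ε)).congr_deriv (by norm_num)
  -- At the maximum `u_x = 0`, so `u_tt = -σ' u_xx ≥ 0`, against `u_tt ≤ -2ε`.
  rw [h.dt_dt, hx1] at htt
  have h1 := hell s hsy.1 y hsy.2 hUq.le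
  nlinarith [mul_nonneg h1 (neg_nonneg.2 hxx)]

theorem le (c : Cell U α a b L R) (h : PeriodicFlow σ U V) (he : EllipticBeyond σ α)
    {t x : ℝ} (ht : t ∈ Icc a b) (hx : x ∈ Icc (L t) (R t)) : U (t, x) ≤ α := by
  rcases he with he | ⟨β, hαβ, w, he⟩
  · exact c.le_of_elliptic h (fun t _ x _ hU => he _ hU) ht hx
  · exact c.le_of_elliptic h (fun t ht x hx hU => he _ hU (c.le_upper h hαβ w ht hx)) ht hx

end Cell

/-! ### Crossing characteristics and the sonic line -/

namespace PeriodicFlow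

variable {σ : ℝ → ℝ} {U V : ℝ × ℝ → ℝ} {α : ℝ}

theorem per_int (h : PeriodicFlow σ U V) (t x : ℝ) (n : ℤ) : U (t, x + n) = U (t, x) := by
  have h1 : Function.Periodic (fun x => U (t, x)) 1 := h.per_U t
  simpa using h1.int_mul n x

/-- A right-moving and a left-moving characteristic enclose the solution in `U ≤ α`. -/
theorem le_of_crossing (h : PeriodicFlow σ U V) (he : EllipticBeyond σ α) {a b : ℝ}
    {g k : ℝ → ℝ} (hab : a ≤ b) (hg : ContinuousOn g (Icc a b)) (hk : ContinuousOn k (Icc a b))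
    (hUg : ∀ s ∈ Icc a b, U (s, g s) < α) (hUk : ∀ s ∈ Icc a b, U (s, -k s) < α) {t : ℝ}
    (ht : t ∈ Icc a b) (hga : g a + 1 ≤ g t) (hgb : g t + 1 ≤ g b) (hka : k a + 1 ≤ k t)
    (hkb : k t + 1 ≤ k b) (x : ℝ) : U (t, x) ≤ α := by
  -- Clamping time to `[a, b]` gives curves continuous on all of `ℝ`, as `Cell` demands.
  set c : ℝ → ℝ := fun s => projIcc a b hab s with hc
  have hcc : Continuous c := continuous_subtype_val.comp continuous_projIcc
  have hcI : ∀ s, c s ∈ Icc a b := fun s => (projIcc a b hab s).2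
  have hcs : ∀ s ∈ Icc a b, c s = s := fun s hs => by simp only [hc, projIcc_of_mem hab hs]
  have hG : Continuous fun s => g (c s) := hg.comp_continuous hcc hcI
  have hK : Continuous fun s => k (c s) := hk.comp_continuous hcc hcI
  -- At time `t`, the point `x` lies between consecutive integer translates of each curve.
  set n := ⌊x - g t⌋ with hn
  set m := ⌊x + k t⌋ with hm
  have hn1 : (n : ℝ) ≤ x - g t := Int.floor_le _
  have hn2 : x - g t < n + 1 := Int.lt_floor_add_one _
  have hm1 : (m : ℝ) ≤ x + k t := Int.floor_le _
  have hm2 : x + k t < m + 1 := Int.lt_floor_add_one _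
  have ha : a ∈ Icc a b := left_mem_Icc.2 hab
  have hb : b ∈ Icc a b := right_mem_Icc.2 hab
  have hU1 : ∀ s ∈ Icc a b, ∀ i : ℤ, U (s, g (c s) + i) < α := fun s hs i => by
    rw [h.per_int, hcs s hs]; exact hUg s hs
  have hU2 : ∀ s ∈ Icc a b, ∀ i : ℤ, U (s, -k (c s) + i) < α := fun s hs i => by
    rw [h.per_int, hcs s hs]; exact hUk s hs
  have cell : Cell U α a b (fun s => max (g (c s) + n) (-k (c s) + m))
      (fun s => min (g (c s) + (n + 1 : ℤ)) (-k (c s) + (m + 1 : ℤ))) := by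
    refine ⟨(hG.add continuous_const).max (hK.neg.add continuous_const),
      (hG.add continuous_const).min (hK.neg.add continuous_const),
      fun s hs => ?_, fun s hs => ?_, ?_, ?_⟩
    · rcases max_choice (g (c s) + (n : ℝ)) (-k (c s) + m) with h1 | h1 <;> rw [h1]
      · exact hU1 s hs n
      · exact hU2 s hs m
    · rcases min_choice (g (c s) + ((n + 1 : ℤ) : ℝ)) (-k (c s) + (m + 1 : ℤ)) with h1 | h1 <;>
        rw [h1]
      · exact hU1 s hs _
      · exact hU2 s hs _
    -- A full turn of both curves before `t` closes the cell at `a`; a full turn after `t` closes it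
    -- at `b`.
    · simp only [hcs a ha]
      push_cast
      refine (min_le_left _ _).trans (le_trans ?_ (le_max_right _ _))
      linarith
    · simp only [hcs b hb]
      push_cast
      refine (min_le_right _ _).trans (le_trans ?_ (le_max_left _ _))
      linarith
  refine cell.le h he ht ⟨?_, ?_⟩
  · simp only [hcs t ht]
    exact max_le (by linarith) (by linarith)
  · simp only [hcs t ht]
    push_cast
    exact le_min (by linarith) (by linarith)

/-- Compression waves of both families cannot both be present. -/
theorem not_both_pos (h : PeriodicFlow σ U V) (w : Wing σ α) (he : EllipticBeyond σ α)
    {t₁ x₁ t₂ x₂ : ℝ} (hU₁ : U (t₁, x₁) < α) (hw₁ : 0 < rate σ U (t₁, x₁))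
    (hU₂ : U (t₂, x₂) < α) (hw₂ : 0 < rate σ (fun p => U (p.1, -p.2)) (t₂, -x₂)) : False := by
  have hU₂' : (fun p : ℝ × ℝ => U (p.1, -p.2)) (t₂, -x₂) < α := by simpa using hU₂
  have hp₁ := wave_pos w hU₁ hw₁
  have hp₂ := wave_pos (U := fun p => U (p.1, -p.2)) w hU₂' hw₂
  obtain ⟨D₁, hD₁, hwind₁⟩ := IsCharacteristic.exists_winding_time h w hp₁
  obtain ⟨D₂, hD₂, hwind₂⟩ := IsCharacteristic.exists_winding_time h.reflect w hp₂
  set D := max D₁ D₂ with hD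
  have hDD₁ : D₁ ≤ D := le_max_left _ _
  have hDD₂ : D₂ ≤ D := le_max_right _ _
  set a := max t₁ t₂ with ha
  -- Both families wind once during the time `D` before `t` and once more during the time `D` after
  -- it.
  have hle : ∀ t, a + D ≤ t → ∀ x, U (t, x) ≤ α := by
    intro t ht x
    obtain ⟨g, -, hg⟩ := h.exists_isCharacteristic w (T := t + D)
      (by linarith [le_max_left t₁ t₂]) hU₁ hw₁
    obtain ⟨k, -, hk⟩ := h.reflect.exists_isCharacteristic w (T := t + D)
      (by linarith [le_max_right t₁ t₂]) hU₂' hw₂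
    replace hg := hg.mono (le_max_left t₁ t₂) le_rfl
    replace hk := hk.mono (le_max_right t₁ t₂) le_rfl
    have h1 : a ∈ Icc a (t + D) := ⟨le_rfl, by linarith⟩
    have h2 : t ∈ Icc a (t + D) := ⟨by linarith, by linarith⟩
    have h3 : t + D ∈ Icc a (t + D) := ⟨by linarith, le_rfl⟩
    exact h.le_of_crossing he h1.2 hg.continuousOn hk.continuousOn (fun s hs => (hg s hs).2.1)
      (fun s hs => (hk s hs).2.1) h2 (hwind₁ _ _ _ hg _ h1 _ h2 (by linarith))
      (hwind₁ _ _ _ hg _ h2 _ h3 (by linarith)) (hwind₂ _ _ _ hk _ h1 _ h2 (by linarith))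
      (hwind₂ _ _ _ hk _ h2 _ h3 (by linarith)) x
  obtain ⟨g, -, hg⟩ := h.exists_isCharacteristic w (T := a + D)
    (by linarith [le_max_left t₁ t₂]) hU₁ hw₁
  obtain ⟨-, h1, h2⟩ := hg (a + D) ⟨by linarith [le_max_left t₁ t₂], le_rfl⟩
  have h3 := h.rate_nonpos_of_le w hle le_rfl h1
  have h4 : 0 < √(speed σ (U (a + D, g (a + D)))) := Real.sqrt_pos.2 (w.speed_pos h1)
  have h5 : wave σ U (a + D, g (a + D)) ≤ 0 := mul_nonpos_of_nonneg_of_nonpos h4.le h3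
  linarith

/-- The solution cannot enter the hyperbolic region transversally. -/
theorem dt_nonneg_of_sonic (h : PeriodicFlow σ U V) (w : Wing σ α) (he : EllipticBeyond σ α)
    {t x : ℝ} (hU : U (t, x) = α) : 0 ≤ dt U (t, x) := by
  by_contra! hlt
  -- At zero speed both rates equal `-u_t > 0`, and they stay positive nearby by continuity.
  have h0 : speed σ (U (t, x)) = 0 := by rw [hU, speed, w.zero]; simp
  have hc : Continuous fun s : ℝ => (s, x) := by fun_prop
  have hc' : Continuous fun s : ℝ => (s, -x) := by fun_prop
  have h1 : ∀ᶠ s in 𝓝 t, 0 < rate σ U (s, x) := by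
    refine (h.cont_rate.comp hc).continuousAt.eventually_mem (isOpen_Ioi.mem_nhds ?_)
    simp only [Function.comp_def, mem_Ioi, rate, h0]
    linarith
  have h2 : ∀ᶠ s in 𝓝 t, 0 < rate σ (fun p => U (p.1, -p.2)) (s, -x) := by
    refine (h.reflect.cont_rate.comp hc').continuousAt.eventually_mem (isOpen_Ioi.mem_nhds ?_)
    simp only [Function.comp_def, mem_Ioi, rate_reflect, h0]
    linarith
  -- Otherwise `t` would be a local minimum in time, with `u_t = 0`.
  have h3 : ∃ᶠ s in 𝓝 t, U (s, x) < α := by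
    intro hev
    have h4 : IsLocalMin (fun s => U (s, x)) t := by
      filter_upwards [hev] with s hs
      rw [hU]
      exact not_lt.1 hs
    have h5 := h4.deriv_eq_zero
    rw [dt] at hlt
    simp only at hlt
    linarith
  obtain ⟨s, hs3, hs1, hs2⟩ := (h3.and_eventually (h1.and h2)).exists
  exact h.not_both_pos w he hs3 hs1 hs3 hs2

theorem dt_eq_zero_of_sonic (h : PeriodicFlow σ U V) (w : Wing σ α) (he : EllipticBeyond σ α)
    {t x : ℝ} (hU : U (t, x) = α) : dt U (t, x) = 0 := by
  refine le_antisymm ?_ (h.dt_nonneg_of_sonic w he hU)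
  have h1 := h.reverse.dt_nonneg_of_sonic w he (t := -t) (x := x) (by simpa using hU)
  rw [dt_comp_neg_time] at h1
  simpa using h1

/-- A flow that never leaves `U ≤ α` is constant. -/
theorem const_of_le (h : PeriodicFlow σ U V) (w : Wing σ α) (hα : ∀ p, U p ≤ α) (p q : ℝ × ℝ) :
    U p = U q := by
  by_cases hex : ∃ r, U r < α
  · obtain ⟨r, hr⟩ := hex
    have h0 : ∀ p, U p ∈ Iio α → dt U p = 0 ∧ dx U p = 0 := by
      rintro ⟨t, x⟩ hp
      refine w.stationary hp (h.rate_nonpos_of_le w (fun _ _ _ => hα _) le_rfl hp)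
        (h.reflect.rate_nonpos_of_le w (fun _ _ _ => hα _) le_rfl ?_)
        (h.reverse.rate_nonpos_of_le w (fun _ _ _ => hα _) le_rfl ?_)
        (h.reverse.reflect.rate_nonpos_of_le w (fun _ _ _ => hα _) le_rfl ?_)
      all_goals simpa using hp
    rw [eq_of_stationary_on h.U1 isOpen_Iio h0 hr p, eq_of_stationary_on h.U1 isOpen_Iio h0 hr q]
  · push Not at hex
    rw [le_antisymm (hα p) (hex p), le_antisymm (hα q) (hex q)]

end PeriodicFlow

/-! ### Integral identities in the elliptic region -/

/-- The fundamental theorem of calculus for a function cut off at a set of its zeros. -/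
theorem integral_indicator_deriv {f f' : ℝ → ℝ} (hf : ∀ x, HasDerivAt f (f' x) x)
    (hf' : Continuous f') {E : Set ℝ} (hE : IsOpen E) (h0 : ∀ x ∈ frontier E, f x = 0) {a b : ℝ} :
    ∫ x in a..b, E.indicator f' x = E.indicator f b - E.indicator f a := by
  have hfc : Continuous f := continuous_iff_continuousAt.2 fun x => (hf x).continuousAt
  refine integral_eq_of_hasDerivAt_off_countable (s := {x | f x = 0 ∧ f' x ≠ 0}) _ _ ?_
    (continuous_indicator h0 hfc.continuousOn).continuousOn ?_ ?_
  -- Zeros of `f` with `f' ≠ 0` are isolated, hence countable. At the other frontier points `f` and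
  -- `f'` both vanish, so the cut-off function has derivative `0`.
  · refine (countable_setOfPred_isolated_right_within (s := {x | f x = 0})).mono ?_
    rintro x ⟨hx, hx'⟩
    refine ⟨hx, ?_⟩
    have h1 : ∀ᶠ z in 𝓝[>] x, f z ≠ 0 :=
      ((hf x).eventually_ne hx').filter_mono (nhdsWithin_mono x fun z hz => ne_of_gt hz)
    rw [← empty_mem_iff_bot, inter_comm, nhdsWithin_inter', mem_inf_principal]
    filter_upwards [h1] with z hz hz'
    exact hz hz'
  · rintro x ⟨-, hx⟩
    by_cases hxE : x ∈ E
    · rw [indicator_of_mem hxE]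
      refine (hf x).congr_of_eventuallyEq ?_
      filter_upwards [hE.mem_nhds hxE] with z hz
      rw [indicator_of_mem hz]
    rw [indicator_of_notMem hxE]
    by_cases hxc : x ∈ closure E
    · have hfx : f x = 0 := h0 x (by rw [hE.frontier_eq]; exact ⟨hxc, hxE⟩)
      have hf'x : f' x = 0 := by
        by_contra hne
        exact hx ⟨hfx, hne⟩
      have h1 := (hf x).isLittleO
      rw [hasDerivAt_iff_isLittleO]
      refine Asymptotics.IsBigO.trans_isLittleO (Asymptotics.IsBigO.of_bound 1 ?_) h1
      refine Eventually.of_forall fun z => ?_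
      rw [indicator_of_notMem hxE, hfx, hf'x]
      by_cases hz : z ∈ E <;> simp [hz]
    · refine (hasDerivAt_const x (0 : ℝ)).congr_of_eventuallyEq ?_
      filter_upwards [isClosed_closure.isOpen_compl.mem_nhds hxc] with z hz
      exact indicator_of_notMem (fun hz' => hz (subset_closure hz')) _
  · rw [intervalIntegrable_iff]
    have hi : IntegrableOn f' (uIoc a b) := hf'.integrableOn_uIoc
    exact hi.indicator hE.measurableSet

theorem integrableOn_indicator_box {G : ℝ × ℝ → ℝ} (hG : Continuous G) {E : Set (ℝ × ℝ)}
    (hE : IsOpen E) (a b c d : ℝ) : IntegrableOn (E.indicator G) (uIoc a b ×ˢ uIoc c d) := by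
  refine IntegrableOn.indicator ?_ hE.measurableSet
  have hi : IntegrableOn G (uIcc a b ×ˢ uIcc c d) :=
    hG.continuousOn.integrableOn_compact (isCompact_uIcc.prod isCompact_uIcc)
  exact hi.mono_set (prod_mono uIoc_subset_uIcc uIoc_subset_uIcc)

theorem integral_box_eq {F : ℝ × ℝ → ℝ} {a b c d : ℝ} (hab : a ≤ b) (hcd : c ≤ d)
    (hF : IntegrableOn F (uIoc a b ×ˢ uIoc c d)) :
    ∫ t in a..b, ∫ x in c..d, F (t, x) = ∫ z in Ioc a b ×ˢ Ioc c d, F z := by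
  rw [uIoc_of_le hab, uIoc_of_le hcd, Measure.volume_eq_prod] at hF
  rw [Measure.volume_eq_prod, setIntegral_prod _ hF, intervalIntegral.integral_of_le hab]
  simp only [intervalIntegral.integral_of_le hcd]

theorem integral_box_eq_swap {F : ℝ × ℝ → ℝ} {a b c d : ℝ} (hab : a ≤ b) (hcd : c ≤ d)
    (hF : IntegrableOn F (uIoc a b ×ˢ uIoc c d)) :
    ∫ x in c..d, ∫ t in a..b, F (t, x) = ∫ z in Ioc a b ×ˢ Ioc c d, F z := by
  rw [← integral_box_eq hab hcd hF]
  exact (intervalIntegral_intervalIntegral_swap (F := fun t x => F (t, x)) hF).symm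

/-- A bounded function on the line with monotone derivative is constant. -/
theorem eq_zero_of_monotone_of_bounded {H D : ℝ → ℝ} {C : ℝ} (hD : Monotone D)
    (hH : ∀ a b, a ≤ b → H b - H a = ∫ t in a..b, D t) (h0 : ∀ t, 0 ≤ H t) (hC : ∀ t, H t ≤ C)
    (t : ℝ) : D t = 0 := by
  have hint : ∀ a b, IntervalIntegrable D volume a b := fun a b => hD.intervalIntegrable
  have hC0 : 0 ≤ C := (h0 t).trans (hC t)
  rcases lt_trichotomy (D t) 0 with hlt | heq | hgt
  · exfalso
    -- Over this length `H` would change by at least `C + 1`, leaving `[0, C]`.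
    set l := (C + 1) / (-D t) with hl
    have hl0 : 0 < l := div_pos (by linarith) (by linarith)
    have h1 : ∫ s in (t - l)..t, D s ≤ ∫ _s in (t - l)..t, D t :=
      intervalIntegral.integral_mono_on (by linarith) (hint _ _) (by simp) fun s hs => hD hs.2
    have h2 : l * D t = -(C + 1) := by
      rw [hl, div_mul_eq_mul_div, div_eq_iff (by linarith)]; ring
    rw [← hH _ _ (by linarith), intervalIntegral.integral_const, sub_sub_cancel, smul_eq_mul,
      h2] at h1
    linarith [h0 t, hC (t - l)]
  · exact heq
  · exfalso
    set l := (C + 1) / D t with hl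
    have hl0 : 0 < l := div_pos (by linarith) hgt
    have h1 : ∫ _s in t..(t + l), D t ≤ ∫ s in t..(t + l), D s :=
      intervalIntegral.integral_mono_on (by linarith) (by simp) (hint _ _) fun s hs => hD hs.1
    have h2 : l * D t = C + 1 := by rw [hl]; field_simp
    rw [← hH _ _ (by linarith), intervalIntegral.integral_const, add_sub_cancel_left, smul_eq_mul,
      h2] at h1
    linarith [h0 t, hC (t + l)]

/-! ### Convexity in time and elliptic bands -/

/-- An open set `J` of elliptic values, the retraction `κ` onto its closure, and the absence of
motion through its boundary. -/
structure Band (σ : ℝ → ℝ) (U : ℝ × ℝ → ℝ) (J : Set ℝ) (κ : ℝ → ℝ) (α : ℝ) : Prop where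
  isOpen : IsOpen J
  pos : ∀ z ∈ J, 0 < deriv σ z
  sonic : ∀ z ∈ frontier J, deriv σ z = 0
  still : ∀ p, U p ∈ frontier J → dt U p = 0
  nonexp : ∀ y z, |κ y - κ z| ≤ |y - z|
  fix : ∀ z ∈ J, κ z = z
  loc_const : ∀ z, z ∉ closure J → ∀ᶠ y in 𝓝 z, κ y = κ z
  lower : ∀ z, α ≤ κ z

namespace Band

variable {σ : ℝ → ℝ} {U V : ℝ × ℝ → ℝ} {J : Set ℝ} {κ : ℝ → ℝ} {α : ℝ}

/-- On the frontier of `J`, `u_t = 0` and `κ` is 1-Lipschitz, so `κ ∘ u` has zero time derivative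
there too. -/
theorem hasDerivAt_retract (B : Band σ U J κ α) (h : PeriodicFlow σ U V) (t x : ℝ) :
    HasDerivAt (fun s => κ (U (s, x))) ((U ⁻¹' J).indicator (dt U) (t, x)) t := by
  have hd := hasDerivAt_dt h.U1 t x
  by_cases hJ : U (t, x) ∈ J
  · rw [indicator_of_mem (show (t, x) ∈ U ⁻¹' J from hJ)]
    refine hd.congr_of_eventuallyEq ?_
    filter_upwards [hd.continuousAt.eventually_mem (B.isOpen.mem_nhds hJ)] with s hs
    exact B.fix _ hs
  rw [indicator_of_notMem (show (t, x) ∉ U ⁻¹' J from hJ)]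
  by_cases hc : U (t, x) ∈ closure J
  · have h0 : dt U (t, x) = 0 := B.still _ (by rw [B.isOpen.frontier_eq]; exact ⟨hc, hJ⟩)
    rw [h0] at hd
    rw [hasDerivAt_iff_isLittleO] at hd ⊢
    refine Asymptotics.IsBigO.trans_isLittleO (Asymptotics.IsBigO.of_bound 1 ?_) hd
    refine Eventually.of_forall fun s => ?_
    simpa using B.nonexp (U (s, x)) (U (t, x))
  · refine (hasDerivAt_const t (κ (U (t, x)))).congr_of_eventuallyEq ?_
    exact hd.continuousAt.eventually (B.loc_const _ hc)

/-- On a band of elliptic values the solution is stationary. -/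
theorem stationary (B : Band σ U J κ α) (h : PeriodicFlow σ U V) (p : ℝ × ℝ) (hp : U p ∈ J) :
    dt U p = 0 ∧ dx U p = 0 := by
  have cU := h.contU
  have ct := continuous_dt h.U1
  have cx := continuous_dx h.U1
  have ctt := continuous_dt (contDiff_dt h.smooth_U)
  have cxx := continuous_dx (contDiff_dx h.smooth_U)
  have cσ := h.cont_dσ.comp h.contU
  have cσσ := h.cont_ddσ.comp h.contU
  simp only [Function.comp_def] at cσ cσσ
  set E : Set (ℝ × ℝ) := U ⁻¹' J with hEdef
  have hE : IsOpen E := B.isOpen.preimage cU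
  -- Here `a = (e^{-u})_t`, and `a_t + b_x = q = e^{-u} (u_t² + σ' u_x²)`, nonnegative on the band.
  -- The weight `e^{-u}` is bounded even when `u` is unbounded above.
  set a : ℝ × ℝ → ℝ := fun p => -(Real.exp (-U p) * dt U p) with ha
  set b : ℝ × ℝ → ℝ := fun p => -(Real.exp (-U p) * (deriv σ (U p) * dx U p)) with hb
  set a' : ℝ × ℝ → ℝ := fun p => Real.exp (-U p) * (dt U p ^ 2 - dt (dt U) p) with ha'
  set b' : ℝ × ℝ → ℝ := fun p => Real.exp (-U p) * (deriv σ (U p) * dx U p ^ 2 -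
    (deriv (deriv σ) (U p) * dx U p ^ 2 + deriv σ (U p) * dx (dx U) p)) with hb'
  set q : ℝ × ℝ → ℝ := fun p =>
    Real.exp (-U p) * (dt U p ^ 2 + deriv σ (U p) * dx U p ^ 2) with hq
  have ca : Continuous a := by simp only [ha]; fun_prop
  have ca' : Continuous a' := by simp only [ha']; fun_prop
  have cb' : Continuous b' := by simp only [hb']; fun_prop
  have cq : Continuous q := by simp only [hq]; fun_prop
  have hsum : ∀ p, a' p + b' p = q p := fun p => by
    simp only [ha', hb', hq, h.dt_dt]
    ring
  have hexpt : ∀ t x, HasDerivAt (fun s => Real.exp (-U (s, x)))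
      (Real.exp (-U (t, x)) * -dt U (t, x)) t := fun t x => (hasDerivAt_dt h.U1 t x).neg.exp
  have hexpx : ∀ t x, HasDerivAt (fun y => Real.exp (-U (t, y)))
      (Real.exp (-U (t, x)) * -dx U (t, x)) x := fun t x => (hasDerivAt_dx h.U1 t x).neg.exp
  have hat : ∀ t x, HasDerivAt (fun s => a (s, x)) (a' (t, x)) t := fun t x =>
    ((hexpt t x).mul (hasDerivAt_dt (contDiff_dt h.smooth_U) t x)).neg.congr_deriv
      (by simp only [ha']; ring)
  have hbx : ∀ t x, HasDerivAt (fun y => b (t, y)) (b' (t, x)) x := fun t x =>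
    ((hexpx t x).mul ((h.hasDerivAt_dσU_space t x).mul
      (hasDerivAt_dx (contDiff_dx h.smooth_U) t x))).neg.congr_deriv
      (by simp only [hb', Pi.mul_apply]; ring)
  -- Both fluxes vanish on the frontier, `a` by stillness and `b` because `σ' = 0`, so the cut-off
  -- creates no boundary terms.
  have hat0 : ∀ p, U p ∈ frontier J → a p = 0 := fun p hp => by simp [ha, B.still p hp]
  have hbx0 : ∀ p, U p ∈ frontier J → b p = 0 := fun p hp => by simp [hb, B.sonic _ hp]
  have cA : Continuous (E.indicator a) :=
    continuous_indicator (fun p hp => hat0 p (cU.frontier_preimage_subset J hp)) ca.continuousOn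
  have cslt : ∀ x : ℝ, Continuous fun s : ℝ => U (s, x) := fun x => by fun_prop
  have cslx : ∀ t : ℝ, Continuous fun y : ℝ => U (t, y) := fun t => by fun_prop
  have hAt : ∀ x t₁ t₂, ∫ t in t₁..t₂, E.indicator a' (t, x) =
      E.indicator a (t₂, x) - E.indicator a (t₁, x) := fun x t₁ t₂ =>
    integral_indicator_deriv (E := (fun s => U (s, x)) ⁻¹' J) (fun t => hat t x)
      (ca'.comp (by fun_prop)) (B.isOpen.preimage (cslt x))
      (fun t ht => hat0 _ ((cslt x).frontier_preimage_subset J ht))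
  have hBx : ∀ t x₁ x₂, ∫ x in x₁..x₂, E.indicator b' (t, x) =
      E.indicator b (t, x₂) - E.indicator b (t, x₁) := fun t x₁ x₂ =>
    integral_indicator_deriv (E := (fun y => U (t, y)) ⁻¹' J) (fun x => hbx t x)
      (cb'.comp (by fun_prop)) (B.isOpen.preimage (cslx t))
      (fun x hx => hbx0 _ ((cslx t).frontier_preimage_subset J hx))
  have hbper : ∀ t x, E.indicator b (t, x + 1) = E.indicator b (t, x) := fun t x => by
    have h1 : (t, x + 1) ∈ E ↔ (t, x) ∈ E := by simp only [hEdef, mem_preimage, h.per_U]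
    by_cases hJ : (t, x) ∈ E
    · rw [indicator_of_mem (h1.2 hJ), indicator_of_mem hJ]
      simp only [h.per_U, hb, h.per_dx]
    · rw [indicator_of_notMem (mt h1.1 hJ), indicator_of_notMem hJ]
  -- Puts `p` in the interior of the period interval, so that a neighbourhood of `p` lies in the box
  -- of integration.
  set x₀ := p.2 - 1 / 2 with hx₀
  have hx01 : x₀ ≤ x₀ + 1 := by linarith
  set D : ℝ → ℝ := fun t => ∫ x in x₀..(x₀ + 1), E.indicator a (t, x) with hD
  set H : ℝ → ℝ := fun t => ∫ x in x₀..(x₀ + 1), Real.exp (-κ (U (t, x))) with hH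
  have hDdiff : ∀ t₁ t₂, t₁ ≤ t₂ →
      D t₂ - D t₁ = ∫ z in Ioc t₁ t₂ ×ˢ Ioc x₀ (x₀ + 1), E.indicator q z := by
    intro t₁ t₂ h12
    have hiA := integrableOn_indicator_box ca' hE t₁ t₂ x₀ (x₀ + 1)
    have hiB := integrableOn_indicator_box cb' hE t₁ t₂ x₀ (x₀ + 1)
    have hqs : E.indicator q = fun z => E.indicator a' z + E.indicator b' z := by
      rw [← indicator_add]
      exact congrArg _ (funext fun z => (hsum z).symm)
    have h1 : ∫ z in Ioc t₁ t₂ ×ˢ Ioc x₀ (x₀ + 1), E.indicator b' z = 0 := by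
      rw [← integral_box_eq h12 hx01 hiB]
      simp only [hBx, hbper, sub_self, intervalIntegral.integral_zero]
    have h2 : ∫ z in Ioc t₁ t₂ ×ˢ Ioc x₀ (x₀ + 1), E.indicator a' z = D t₂ - D t₁ := by
      rw [← integral_box_eq_swap h12 hx01 hiA]
      simp only [hAt]
      exact intervalIntegral.integral_sub
        ((cA.comp (show Continuous fun y : ℝ => (t₂, y) by fun_prop)).intervalIntegrable _ _)
        ((cA.comp (show Continuous fun y : ℝ => (t₁, y) by fun_prop)).intervalIntegrable _ _)
    rw [uIoc_of_le h12, uIoc_of_le hx01] at hiA hiB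
    rw [hqs, integral_add hiA hiB, h1, h2, add_zero]
  have hq0 : ∀ z, 0 ≤ E.indicator q z := fun z =>
    indicator_nonneg (fun z hz => by
      have h1 := (B.pos _ hz).le
      simp only [hq]
      positivity) z
  have hmono : Monotone D := fun t₁ t₂ h12 => by
    have h1 := hDdiff t₁ t₂ h12
    have h2 : 0 ≤ ∫ z in Ioc t₁ t₂ ×ˢ Ioc x₀ (x₀ + 1), E.indicator q z :=
      integral_nonneg hq0
    linarith
  have cκ : Continuous κ := by
    refine LipschitzWith.continuous (K := 1) (LipschitzWith.of_dist_le_mul fun y z => ?_)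
    simpa [Real.dist_eq] using B.nonexp y z
  have hκ : ∀ t x, HasDerivAt (fun s => Real.exp (-κ (U (s, x)))) (E.indicator a (t, x)) t := by
    intro t x
    refine (B.hasDerivAt_retract h t x).neg.exp.congr_deriv ?_
    by_cases hJ : (t, x) ∈ E
    · rw [indicator_of_mem hJ, indicator_of_mem hJ]
      simp [ha, B.fix _ hJ]
    · rw [indicator_of_notMem hJ, indicator_of_notMem hJ]
      simp
  have cH : Continuous fun z : ℝ × ℝ => Real.exp (-κ (U z)) := by fun_prop
  have iH : ∀ t, IntervalIntegrable (fun x => Real.exp (-κ (U (t, x)))) volume x₀ (x₀ + 1) :=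
    fun t => (cH.comp (show Continuous fun y : ℝ => (t, y) by fun_prop)).intervalIntegrable _ _
  have hHD : ∀ t₁ t₂, t₁ ≤ t₂ → H t₂ - H t₁ = ∫ t in t₁..t₂, D t := by
    intro t₁ t₂ h12
    have hiA := integrableOn_indicator_box ca hE t₁ t₂ x₀ (x₀ + 1)
    rw [hD, integral_box_eq h12 hx01 hiA, ← integral_box_eq_swap h12 hx01 hiA, hH]
    simp only
    rw [← intervalIntegral.integral_sub (iH t₂) (iH t₁)]
    congr 1
    funext x
    exact (intervalIntegral.integral_eq_sub_of_hasDerivAt (fun t _ => hκ t x)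
      ((cA.comp (show Continuous fun s : ℝ => (s, x) by fun_prop)).intervalIntegrable _ _)).symm
  have hH0 : ∀ t, 0 ≤ H t := fun t =>
    intervalIntegral.integral_nonneg hx01 fun x _ => (Real.exp_pos _).le
  have hH1 : ∀ t, H t ≤ Real.exp (-α) := fun t => by
    have h1 : H t ≤ ∫ _x in x₀..(x₀ + 1), Real.exp (-α) :=
      intervalIntegral.integral_mono_on hx01 (iH t) (by simp) fun x _ =>
        Real.exp_le_exp.2 (neg_le_neg (B.lower _))
    simpa using h1
  have hD0 := eq_zero_of_monotone_of_bounded hmono hHD hH0 hH1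
  -- `D` vanishes identically, so the nonnegative cut-off of `q` has zero integral over a box around
  -- `p`.
  have hqp : q p = 0 := by
    by_contra hne
    have h12 : p.1 - 1 ≤ p.1 + 1 := by linarith
    have h1 := hDdiff (p.1 - 1) (p.1 + 1) h12
    rw [hD0, hD0, sub_zero] at h1
    have hi := integrableOn_indicator_box cq hE (p.1 - 1) (p.1 + 1) x₀ (x₀ + 1)
    rw [uIoc_of_le h12, uIoc_of_le hx01] at hi
    have h2 := (setIntegral_pos_iff_support_of_nonneg_ae
      (Eventually.of_forall fun z => hq0 z) hi).2 ?_
    · linarith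
    have ho : IsOpen ((E ∩ {z | q z ≠ 0}) ∩
        (Ioo (p.1 - 1) (p.1 + 1) ×ˢ Ioo x₀ (x₀ + 1))) :=
      (hE.inter (isOpen_ne_fun cq continuous_const)).inter (isOpen_Ioo.prod isOpen_Ioo)
    refine (ho.measure_pos volume ⟨p, ⟨hp, hne⟩, ?_⟩).trans_le (measure_mono ?_)
    · refine ⟨⟨by linarith, by linarith⟩, ?_, ?_⟩ <;> rw [hx₀] <;> linarith
    · rintro z ⟨⟨hz1, hz2⟩, hz3⟩
      refine ⟨?_, prod_mono Ioo_subset_Ioc_self Ioo_subset_Ioc_self hz3⟩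
      rw [Function.mem_support, indicator_of_mem hz1]
      exact hz2
  have hpos := B.pos _ hp
  have h1 := (mul_eq_zero.1 hqp).resolve_left (Real.exp_pos _).ne'
  have h2 : dt U p ^ 2 = 0 := by
    nlinarith [sq_nonneg (dt U p), mul_nonneg hpos.le (sq_nonneg (dx U p))]
  have h3 : deriv σ (U p) * dx U p ^ 2 = 0 := by linarith
  exact ⟨by simpa using h2, by simpa [hpos.ne'] using h3⟩

end Band

/-! ### Constancy for the two types of stress function -/

theorem Wing.deriv_eq_zero {σ : ℝ → ℝ} {β : ℝ} (w : Wing (fun z => -σ (-z)) (-β)) :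
    deriv σ β = 0 := by
  have h := w.zero
  rw [deriv_odd_reflection] at h
  simpa only [neg_neg] using h

namespace PeriodicFlow

variable {σ : ℝ → ℝ} {U V : ℝ × ℝ → ℝ} {α : ℝ}

theorem band_of_right_elliptic (h : PeriodicFlow σ U V) (w : Wing σ α)
    (hpos : ∀ z, α < z → 0 < deriv σ z) : Band σ U (Ioi α) (max α) α where
  isOpen := isOpen_Ioi
  pos := hpos
  sonic z hz := by
    rw [frontier_Ioi, mem_singleton_iff] at hz
    rw [hz, w.zero]
  still p hp := by
    rw [frontier_Ioi, mem_singleton_iff] at hp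
    exact h.dt_eq_zero_of_sonic w (.inl fun z hz => by
      rcases hz.lt_or_eq with hz | rfl
      · exact (hpos z hz).le
      · exact w.zero.ge) hp
  nonexp y z := abs_max_sub_max_le_max α y α z |>.trans (by simp)
  fix z hz := max_eq_right (le_of_lt hz)
  loc_const z hz := by
    rw [closure_Ioi, mem_Ici, not_le] at hz
    filter_upwards [isOpen_Iio.mem_nhds hz] with y hy
    rw [max_eq_left (le_of_lt hy), max_eq_left hz.le]
  lower z := le_max_left _ _

/-- Stillness at `β` is stillness at the lower sonic value `-β` of the negated flow. -/
theorem band_of_strip (h : PeriodicFlow σ U V) (w : Wing σ α) {β : ℝ} (hαβ : α < β)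
    (w' : Wing (fun z => -σ (-z)) (-β)) (hpos : ∀ z, α < z → z < β → 0 < deriv σ z) :
    Band σ U (Ioo α β) (fun z => max α (min β z)) α where
  isOpen := isOpen_Ioo
  pos z hz := hpos z hz.1 hz.2
  sonic z hz := by
    have hz' : deriv σ β = 0 := w'.deriv_eq_zero
    rw [frontier_Ioo hαβ, mem_insert_iff, mem_singleton_iff] at hz
    rcases hz with rfl | rfl
    · exact w.zero
    · exact hz'
  still := by
    have hz' : deriv σ β = 0 := w'.deriv_eq_zero
    have hnn : ∀ z, α ≤ z → z ≤ β → 0 ≤ deriv σ z := fun z h1 h2 => by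
      rcases h1.lt_or_eq with h1 | rfl
      · rcases h2.lt_or_eq with h2 | rfl
        · exact (hpos z h1 h2).le
        · exact hz'.ge
      · exact w.zero.ge
    rintro ⟨t, x⟩ hp
    rw [frontier_Ioo hαβ, mem_insert_iff, mem_singleton_iff] at hp
    rcases hp with hp | hp
    · exact h.dt_eq_zero_of_sonic w (.inr ⟨β, hαβ, w', hnn⟩) hp
    · have h1 := h.negate.dt_eq_zero_of_sonic w' (t := t) (x := x)
        (.inr ⟨-α, neg_lt_neg hαβ, by simpa using w, fun z h1 h2 => by
          rw [deriv_odd_reflection]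
          exact hnn _ (by linarith) (by linarith)⟩) (by rw [hp])
      rw [dt_neg] at h1
      linarith
  nonexp y z := by
    refine (abs_max_sub_max_le_max α _ α _).trans ?_
    rw [sub_self, abs_zero, max_eq_right (abs_nonneg _)]
    refine (abs_min_sub_min_le_max β y β z).trans (by simp)
  fix z hz := by rw [min_eq_right hz.2.le, max_eq_right hz.1.le]
  loc_const z hz := by
    rw [closure_Ioo hαβ.ne, mem_Icc, not_and_or, not_le, not_le] at hz
    rcases hz with hz | hz
    · filter_upwards [isOpen_Iio.mem_nhds hz] with y hy
      rw [mem_Iio] at hy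
      rw [max_eq_left ((min_le_right _ _).trans hy.le), max_eq_left ((min_le_right _ _).trans hz.le)]
    · filter_upwards [isOpen_Ioi.mem_nhds hz] with y hy
      rw [mem_Ioi] at hy
      rw [min_eq_left hy.le, min_eq_left hz.le]
  lower z := le_max_left _ _

theorem const_of_typeI (h : PeriodicFlow σ U V) (hσ : IsTypeI σ) (p q : ℝ × ℝ) : U p = U q := by
  obtain ⟨α, hmin, hconv⟩ := hσ.exists_min
  have hd : Differentiable ℝ σ := h.smooth_σ.differentiable two_ne_zero
  have hzero : deriv σ α = 0 := (hmin.isLocalMin univ_mem).deriv_eq_zero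
  have hmono : StrictMono (deriv σ) := by
    intro y z hyz
    exact (hσ.strictConvex.strictMonoOn_deriv (fun x _ => hd x)) (mem_univ y) (mem_univ z) hyz
  have w : Wing σ α := ⟨fun z hz => hzero ▸ hmono hz, hzero, hconv⟩
  have B := h.band_of_right_elliptic w fun z hz => hzero ▸ hmono hz
  by_cases hex : ∃ r, U r ∈ Ioi α
  · obtain ⟨r, hr⟩ := hex
    rw [eq_of_stationary_on h.U1 B.isOpen (B.stationary h) hr p,
      eq_of_stationary_on h.U1 B.isOpen (B.stationary h) hr q]
  · push Not at hex
    exact h.const_of_le w (fun r => not_lt.1 (hex r)) p q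

theorem const_of_typeII (h : PeriodicFlow σ U V) (hσ : IsTypeII σ) (p q : ℝ × ℝ) : U p = U q := by
  obtain ⟨α, β, hαβ, h1, h2, h3, h4, h5⟩ := hσ.exists_signs
  have hα : deriv σ α = 0 := by
    refine le_antisymm ?_ ?_
    · exact closure_minimal (s := Iio α) (fun z hz => (h1 z hz).le)
        (isClosed_le h.cont_dσ continuous_const) (by simp)
    · exact closure_minimal (s := Ioo α β) (fun z hz => (h3 z hz.1 hz.2).le)
        (isClosed_le continuous_const h.cont_dσ)
        (by rw [closure_Ioo hαβ.ne]; exact ⟨le_rfl, hαβ.le⟩)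
  have hβ : deriv σ β = 0 := by
    refine le_antisymm ?_ ?_
    · exact closure_minimal (s := Ioi β) (fun z hz => (h2 z hz).le)
        (isClosed_le h.cont_dσ continuous_const) (by simp)
    · exact closure_minimal (s := Ioo α β) (fun z hz => (h3 z hz.1 hz.2).le)
        (isClosed_le continuous_const h.cont_dσ)
        (by rw [closure_Ioo hαβ.ne]; exact ⟨hαβ.le, le_rfl⟩)
  have w : Wing σ α := ⟨h1, hα, h4⟩
  have w' : Wing (fun z => -σ (-z)) (-β) := by
    refine ⟨fun z hz => ?_, ?_, fun z hz => ?_⟩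
    · rw [deriv_odd_reflection]
      exact h2 _ (by linarith)
    · rw [deriv_odd_reflection]
      simpa using hβ
    · rw [deriv_deriv_odd_reflection]
      have := h5 (-z) (by linarith)
      simpa using this
  have B := h.band_of_strip w hαβ w' h3
  by_cases hex : ∃ r, U r ∈ Ioo α β
  · obtain ⟨r, hr⟩ := hex
    rw [eq_of_stationary_on h.U1 B.isOpen (B.stationary h) hr p,
      eq_of_stationary_on h.U1 B.isOpen (B.stationary h) hr q]
  push Not at hex
  have hpre : IsPreconnected (range U) := isPreconnected_range h.contU
  by_cases hlow : ∀ r, U r ≤ α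
  · exact h.const_of_le w hlow p q
  · push Not at hlow
    obtain ⟨r, hr⟩ := hlow
    -- The range of `U` is connected and misses `(α, β)`, so one value above `α` puts all of it in
    -- `[β, ∞)`.
    have hup : ∀ s, β ≤ U s := by
      intro s
      by_contra! hs
      have hr' : β ≤ U r := not_lt.1 fun hlt => hex r ⟨hr, hlt⟩
      have hs' : U s ≤ α := not_lt.1 fun hlt => hex s ⟨hlt, hs⟩
      obtain ⟨z, hz⟩ := hpre.Icc_subset (mem_range_self s) (mem_range_self r)
        (show (α + β) / 2 ∈ Icc (U s) (U r) from ⟨by linarith, by linarith⟩)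
      exact hex z ⟨by linarith, by linarith⟩
    have := h.negate.const_of_le w' (fun s => neg_le_neg (hup s)) p q
    linarith

end PeriodicFlow

theorem IsPSystemSolution.periodicFlow {σ : ℝ → ℝ} {u v : ℝ → ℝ → ℝ}
    (huv : IsPSystemSolution σ u v) (hσ : ContDiff ℝ 2 σ) (hu : ∀ t x : ℝ, u t (x + 1) = u t x)
    (hv : ∀ t x : ℝ, v t (x + 1) = v t x) :
    PeriodicFlow σ (fun p => u p.1 p.2) (fun p => v p.1 p.2) where
  smooth_σ := hσ
  smooth_U := huv.contDiff_u
  smooth_V := huv.contDiff_v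
  per_U := hu
  per_V := hv
  eq_U p := huv.eq_u p.1 p.2
  eq_V p := by
    refine (huv.eq_v p.1 p.2).trans ?_
    have h1 := hasDerivAt_dx (huv.contDiff_u.of_le one_le_two) p.1 p.2
    have h2 : HasDerivAt σ (deriv σ (u p.1 p.2)) (u p.1 p.2) :=
      (hσ.differentiable two_ne_zero _).hasDerivAt
    exact (HasDerivAt.comp (h := fun y => u p.1 y) p.2 h2 h1).deriv

theorem theorem2 (σ : ℝ → ℝ) (hσ : IsTypeI σ ∨ IsTypeII σ)
    (u v : ℝ → ℝ → ℝ) (huv : IsPSystemSolution σ u v)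
    (hu : ∀ t x : ℝ, u t (x + 1) = u t x)
    (hv : ∀ t x : ℝ, v t (x + 1) = v t x) :
    ∃ a b : ℝ, ∀ t x : ℝ, u t x = a ∧ v t x = b := by
  have hσ2 : ContDiff ℝ 2 σ := hσ.elim (·.contDiff) (·.contDiff)
  have h := huv.periodicFlow hσ2 hu hv
  have hU : ∀ p q : ℝ × ℝ, u p.1 p.2 = u q.1 q.2 := by
    rcases hσ with hσ | hσ
    · exact h.const_of_typeI hσ
    · exact h.const_of_typeII hσ
  have hUt : ∀ p, dt (fun p : ℝ × ℝ => u p.1 p.2) p = 0 := fun p => by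
    exact (congrArg (deriv · p.1) (funext fun s => hU (s, p.2) (0, 0))).trans (deriv_const _ _)
  have hUx : ∀ p, dx (fun p : ℝ × ℝ => u p.1 p.2) p = 0 := fun p => by
    exact (congrArg (deriv · p.2) (funext fun s => hU (p.1, s) (0, 0))).trans (deriv_const _ _)
  refine ⟨u 0 0, v 0 0, fun t x => ⟨hU (t, x) (0, 0), ?_⟩⟩
  refine is_const_of_fderiv_eq_zero (𝕜 := ℝ) (h.V1.differentiable one_ne_zero) (fun p => ?_)
    (t, x) (0, 0)
  refine fderiv_eq_zero_of_partial h.V1 ?_ ?_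
  · rw [h.eq_V, hUx, mul_zero]
  · have := h.eq_U p
    rw [hUt] at this
    linarith
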